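/- **Conventions.** All vector spaces are real and all locally convex spaces are Hausdorff. A curve $c:\mathbb R\to E$ into a locally convex space is *smooth* if all its derivatives exist and are continuous; $C^\infty(\mathbb R,E)$ is the space of smooth curves. A sequence $(x_n)$ in $E$ is *Mackey–Cauchy* if there are reals $\lambda_{n,m}>0$ with $\lambda_{n,m}\to\infty$ as $n,m\to\infty$ such that $\{\lambda_{n,m}(x_n-x_m): n,m\in\mathbb N\}$ is bounded in $E$; $E$ is a *convenient vector space* if every Mackey–Cauchy sequence in $E$ converges. A map $f:E\to F$ is *smooth* if $f\circ c$ is a smooth curve for every smooth curve $c$ in $E$; $C^\infty(E,F)$ is the vector space of smooth maps. The *bornologification* of a locally convex topology is the finest locally convex topology with the same bounded sets. The space $C^\infty(\mathbb R,E)$ of smooth curves carries the bornologification of the topology of uniform convergence on compact sets in all derivatives separately, and $C^\infty(E,F)$ carries the bornologification of the initial topology with respect to all maps $c^*:C^\infty(E,F)\to C^\infty(\mathbb R,F)$, $c^*(f)=f\circ c$, with $c$ a smooth curve in $E$. **Theorem.** The category of convenient vector spaces and smooth maps, with finite products given by the usual products $E\times F$ (with the product topology), is cartesian closed. For convenient vector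 spaces $F,G$ the space $C^\infty(F,G)$ is again convenient, and for convenient $E,F,G$ there is a bijection $$\Phi: C^\infty(E\times F,G)\;\cong\; C^\infty(E,C^\infty(F,G)),\qquad \Phi(f)(x)(y)=f(x,y),$$ which is natural in $E,F,G$ (for smooth $a:E'\to E$, $b:F'\to F$, $h:G\to G'$ one has $\Phi(h\circ f\circ(a\times b))(x)=h\circ\Phi(f)(a(x))\circ b$ for all $x\in E'$), and which is a diffeomorphism, i.e. $\Phi$ and $\Phi^{-1}$ are smooth maps. -/

import Mathlib

open Filter Topology Bornology Set
open CategoryTheory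

universe u v w

noncomputable section

namespace Convenient

/-! ### Smooth curves and smooth maps -/

section Smooth

/-- A curve `c : ℝ → E` is smooth if all its iterated derivatives exist and are continuous. -/
def IsSmoothCurve {E : Type*} [AddCommGroup E] [Module ℝ E] [TopologicalSpace E]
    (c : ℝ → E) : Prop :=
  ∀ n : ℕ, Continuous (deriv^[n] c) ∧ Differentiable ℝ (deriv^[n] c)

/-- A map is smooth if it sends smooth curves to smooth curves. -/
def IsSmoothMap {E F : Type*} [AddCommGroup E] [Module ℝ E] [TopologicalSpace E]
    [AddCommGroup F] [Module ℝ F] [TopologicalSpace F] (f : E → F) : Prop :=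
  ∀ c : ℝ → E, IsSmoothCurve c → IsSmoothCurve (f ∘ c)

variable {E : Type*} [AddCommGroup E] [Module ℝ E] [TopologicalSpace E]
  [IsTopologicalAddGroup E] [ContinuousSMul ℝ E]
variable {F : Type*} [AddCommGroup F] [Module ℝ F] [TopologicalSpace F]
  [IsTopologicalAddGroup F] [ContinuousSMul ℝ F]

/-- The derivative of a curve is the limit of its difference quotients. -/
theorem hasDerivAt_iff_tendsto_quotient {c : ℝ → E} {a : E} {t : ℝ} :
    HasDerivAt c a t ↔ Tendsto (fun s => (s - t)⁻¹ • (c s - c t)) (𝓝[≠] t) (𝓝 a) := by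
  have h1 : HasDerivAt c a t ↔
      Asymptotics.IsLittleOTVS ℝ (𝓝 t) (fun s => c s - c t - (s - t) • a) (fun s => s - t) := by
    rw [hasDerivAt_iff_hasFDerivAt, hasFDerivAt_iff_isLittleOTVS]
    simp [ContinuousLinearMap.toSpanSingleton_apply]
  rw [h1, Asymptotics.isLittleOTVS_iff_tendsto_inv_smul
    (Eventually.of_forall fun s hs => by
      have : s = t := sub_eq_zero.mp hs
      simp [this])]
  have h2 : Tendsto (fun s => (s - t)⁻¹ • (c s - c t - (s - t) • a)) (𝓝 t) (𝓝 0) ↔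
      Tendsto (fun s => (s - t)⁻¹ • (c s - c t - (s - t) • a)) (𝓝[≠] t) (𝓝 0) := by
    rw [← pure_sup_nhdsNE]
    simp only [tendsto_sup]
    refine ⟨fun h => h.2, fun h => ⟨?_, h⟩⟩
    rw [tendsto_pure_left]
    intro s hs
    simpa using mem_of_mem_nhds hs
  rw [h2]
  have h3 : Tendsto (fun s => (s - t)⁻¹ • (c s - c t - (s - t) • a)) (𝓝[≠] t) (𝓝 0) ↔
      Tendsto (fun s => (s - t)⁻¹ • (c s - c t) - a) (𝓝[≠] t) (𝓝 0) := by
    refine tendsto_congr' ?_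
    filter_upwards [self_mem_nhdsWithin] with s hs
    have : s - t ≠ 0 := sub_ne_zero.mpr hs
    rw [smul_sub, smul_smul, inv_mul_cancel₀ this, one_smul]
  rw [h3]
  constructor
  · intro h
    simpa using h.add_const a
  · intro h
    simpa using h.sub_const a

theorem hasDerivAt_deriv {c : ℝ → E} {t : ℝ} (h : DifferentiableAt ℝ c t) :
    HasDerivAt c (deriv c t) t := by
  have h1 : HasFDerivAt c (fderiv ℝ c t) t := h.hasFDerivAt
  rw [hasDerivAt_iff_hasFDerivAt]
  have h2 : ContinuousLinearMap.toSpanSingleton ℝ (deriv c t) = fderiv ℝ c t := by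
    ext
    simp [deriv]
  rw [h2]
  exact h1

theorem deriv_eq_of_hasDerivAt [T2Space E] {c : ℝ → E} {a : E} {t : ℝ} (h : HasDerivAt c a t) :
    deriv c t = a :=
  tendsto_nhds_unique
    (hasDerivAt_iff_tendsto_quotient.1
      (hasDerivAt_deriv (hasDerivAt_iff_hasFDerivAt.1 h).differentiableAt))
    (hasDerivAt_iff_tendsto_quotient.1 h)

theorem iterate_deriv_eq [T2Space E] {g : ℕ → ℝ → E}
    (hg : ∀ n t, HasDerivAt (g n) (g (n + 1) t) t) (n : ℕ) : deriv^[n] (g 0) = g n := by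
  induction n with
  | zero => rfl
  | succ n ih => 
    rw [Function.iterate_succ_apply', ih]
    exact funext fun t => deriv_eq_of_hasDerivAt (hg n t)

theorem isSmoothCurve_of_seq [T2Space E] {g : ℕ → ℝ → E} (hc : ∀ n, Continuous (g n))
    (hg : ∀ n t, HasDerivAt (g n) (g (n + 1) t) t) : IsSmoothCurve (g 0) := fun n => by
  rw [iterate_deriv_eq hg]
  exact ⟨hc n, fun t => (hasDerivAt_iff_hasFDerivAt.1 (hg n t)).differentiableAt⟩

theorem IsSmoothCurve.hasDerivAt {c : ℝ → E} (hc : IsSmoothCurve c) (n : ℕ) (t : ℝ) :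
    HasDerivAt (deriv^[n] c) (deriv^[n + 1] c t) t := by
  rw [Function.iterate_succ_apply']
  exact hasDerivAt_deriv ((hc n).2 t)

theorem IsSmoothCurve.add [T2Space E] {c d : ℝ → E} (hc : IsSmoothCurve c)
    (hd : IsSmoothCurve d) : IsSmoothCurve (c + d) := by
  refine isSmoothCurve_of_seq (g := fun n t => deriv^[n] c t + deriv^[n] d t)
    (fun n => (hc n).1.add (hd n).1) fun n t => ?_
  have h1 := hasDerivAt_iff_tendsto_quotient.1 (hc.hasDerivAt n t)
  have h2 := hasDerivAt_iff_tendsto_quotient.1 (hd.hasDerivAt n t)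
  refine hasDerivAt_iff_tendsto_quotient.2 ((h1.add h2).congr fun s => ?_)
  rw [← smul_add]
  congr 1
  abel

theorem IsSmoothCurve.const [T2Space E] (a : E) : IsSmoothCurve fun _ : ℝ => a := by
  refine isSmoothCurve_of_seq (g := fun n _ => if n = 0 then a else 0)
    (fun n => continuous_const) fun n t => ?_
  refine hasDerivAt_iff_tendsto_quotient.2 ?_
  simp

/-- Continuous linear maps preserve smooth curves. -/
theorem IsSmoothCurve.clm [T2Space F] (L : E →L[ℝ] F) {c : ℝ → E} (hc : IsSmoothCurve c) :
    IsSmoothCurve (L ∘ c) := by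
  refine isSmoothCurve_of_seq (g := fun n t => L (deriv^[n] c t))
    (fun n => L.continuous.comp (hc n).1) fun n t => ?_
  have h1 := hasDerivAt_iff_tendsto_quotient.1 (hc.hasDerivAt n t)
  refine hasDerivAt_iff_tendsto_quotient.2
    (((L.continuous.tendsto _).comp h1).congr fun s => ?_)
  simp

theorem IsSmoothCurve.prodMk [T2Space E] [T2Space F] {c : ℝ → E} {d : ℝ → F}
    (hc : IsSmoothCurve c) (hd : IsSmoothCurve d) : IsSmoothCurve fun t => (c t, d t) := by
  refine isSmoothCurve_of_seq (g := fun n t => (deriv^[n] c t, deriv^[n] d t))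
    (fun n => (hc n).1.prodMk (hd n).1) fun n t => ?_
  have h1 := hasDerivAt_iff_tendsto_quotient.1 (hc.hasDerivAt n t)
  have h2 := hasDerivAt_iff_tendsto_quotient.1 (hd.hasDerivAt n t)
  exact hasDerivAt_iff_tendsto_quotient.2 (h1.prodMk_nhds h2)

end Smooth

/-! ### Convenient vector spaces -/

/-- A sequence is Mackey-Cauchy if there are `l n m > 0` tending to infinity such that
`{l n m • (x n - x m)}` is bounded. -/
def IsMackeyCauchy {E : Type*} [AddCommGroup E] [Module ℝ E] [TopologicalSpace E]
    (x : ℕ → E) : Prop :=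
  ∃ l : ℕ × ℕ → ℝ, (∀ p, 0 < l p) ∧ Tendsto l atTop atTop ∧
    IsVonNBounded ℝ (range fun p : ℕ × ℕ => l p • (x p.1 - x p.2))

/-- A convenient vector space: a Hausdorff locally convex real vector space in which every
Mackey-Cauchy sequence converges. -/
class ConvenientSpace (E : Type*) [AddCommGroup E] [Module ℝ E] [TopologicalSpace E] : Prop
    extends IsTopologicalAddGroup E, ContinuousSMul ℝ E, LocallyConvexSpace ℝ E, T2Space E where
  mackey_complete : ∀ x : ℕ → E, IsMackeyCauchy x → ∃ a, Tendsto x atTop (𝓝 a)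

theorem IsMackeyCauchy.clm {E F : Type*} [AddCommGroup E] [Module ℝ E] [TopologicalSpace E]
    [AddCommGroup F] [Module ℝ F] [TopologicalSpace F] (L : E →L[ℝ] F) {x : ℕ → E}
    (hx : IsMackeyCauchy x) : IsMackeyCauchy (L ∘ x) := by
  obtain ⟨l, h0, h1, h2⟩ := hx
  refine ⟨l, h0, h1, ?_⟩
  have := h2.image L
  rw [← range_comp] at this
  simpa [Function.comp_def] using this

instance prodConvenient {E F : Type*} [AddCommGroup E] [Module ℝ E] [TopologicalSpace E]
    [AddCommGroup F] [Module ℝ F] [TopologicalSpace F] [ConvenientSpace E] [ConvenientSpace F] :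
    ConvenientSpace (E × F) where
  mackey_complete x hx := by
    obtain ⟨a, ha⟩ := ConvenientSpace.mackey_complete _ (hx.clm (ContinuousLinearMap.fst ℝ E F))
    obtain ⟨b, hb⟩ := ConvenientSpace.mackey_complete _ (hx.clm (ContinuousLinearMap.snd ℝ E F))
    exact ⟨(a, b), ha.prodMk_nhds hb⟩

instance punitConvenient : ConvenientSpace PUnit.{u + 1} where
  convex_basis x := by
    rw [nhds_discrete]
    exact (hasBasis_pure x).to_hasBasis
      (fun _ _ => ⟨{x}, ⟨mem_pure.2 rfl, convex_singleton x⟩, subset_rfl⟩)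
      (fun s hs => ⟨(), trivial, singleton_subset_iff.2 (mem_pure.1 hs.1)⟩)
  mackey_complete x _ := ⟨PUnit.unit, by simp [nhds_discrete, tendsto_pure]⟩

/-! ### Bornologification -/

section Bornologification

variable (V : Type*) [AddCommGroup V] [Module ℝ V]

/-- The locally convex vector space topologies on `V` in which every `t`-bounded set is bounded. -/
def bornologificationSet (t : TopologicalSpace V) : Set (TopologicalSpace V) :=
  {s | @IsTopologicalAddGroup V s _ ∧ @ContinuousSMul ℝ V _ _ s ∧
    @LocallyConvexSpace ℝ V _ _ _ _ s ∧
    ∀ B : Set V, @IsVonNBounded ℝ V _ _ _ t B → @IsVonNBounded ℝ V _ _ _ s B}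

/-- The bornologification of a locally convex topology `t`: the finest locally convex topology
in which all `t`-bounded sets are bounded. (The infimum of topologies is taken in Mathlib's order,
where finer topologies are smaller.) -/
@[reducible]
def bornologification (t : TopologicalSpace V) : TopologicalSpace V :=
  sInf (bornologificationSet V t)

variable (t : TopologicalSpace V)

theorem bornologification_addGroup : @IsTopologicalAddGroup V (bornologification V t) _ :=
  topologicalAddGroup_sInf fun _ h => h.1

theorem bornologification_smul : @ContinuousSMul ℝ V _ _ (bornologification V t) :=
  continuousSMul_sInf fun _ h => h.2.1

theorem bornologification_lcs : @LocallyConvexSpace ℝ V _ _ _ _ (bornologification V t) :=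
  LocallyConvexSpace.sInf fun _ h => h.2.2.1

/-- Linear maps that are continuous for `t` are continuous for its bornologification. -/
theorem continuous_bornologification {W : Type*} [AddCommGroup W] [Module ℝ W]
    [tW : TopologicalSpace W] [IsTopologicalAddGroup W] [ContinuousSMul ℝ W]
    [LocallyConvexSpace ℝ W] (L : V →ₗ[ℝ] W) (hL : Continuous[t, tW] L) :
    Continuous[bornologification V t, tW] L := by
  refine continuous_iff_le_induced.2 (sInf_le ⟨topologicalAddGroup_induced L,
    continuousSMul_induced L, LocallyConvexSpace.induced L, fun B hB => ?_⟩)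
  exact hB.of_topologicalSpace_le (continuous_iff_le_induced.1 hL)

end Bornologification

/-! ### The space of smooth curves -/

section SmoothCurve

variable (E : Type*) [AddCommGroup E] [Module ℝ E] [TopologicalSpace E]
  [IsTopologicalAddGroup E] [ContinuousSMul ℝ E] [T2Space E]

def smoothCurves : Submodule ℝ (ℝ → E) where
  carrier := {c | IsSmoothCurve c}
  zero_mem' := IsSmoothCurve.const 0
  add_mem' := IsSmoothCurve.add
  smul_mem' a _ hc := hc.clm (a • ContinuousLinearMap.id ℝ E)

/-- The vector space `C^∞(ℝ, E)` of smooth curves. -/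
def SmoothCurve : Type _ := smoothCurves E

instance : AddCommGroup (SmoothCurve E) := inferInstanceAs (AddCommGroup (smoothCurves E))
instance : Module ℝ (SmoothCurve E) := inferInstanceAs (Module ℝ (smoothCurves E))

variable {E}

/-- The `n`-th derivative of a smooth curve, as a continuous map. -/
def SmoothCurve.iterDeriv (n : ℕ) (c : SmoothCurve E) : C(ℝ, E) :=
  ⟨deriv^[n] c.1, (c.2 n).1⟩

variable (E)

/-- The topology of uniform convergence on compact sets in all derivatives separately:
the initial topology for the maps `c ↦ c⁽ⁿ⁾ ∈ C(ℝ, E)`, where `C(ℝ, E)` has the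
compact-open topology, i.e. the topology of uniform convergence on compact sets. -/
@[reducible]
def SmoothCurve.compactConvergence : TopologicalSpace (SmoothCurve E) :=
  ⨅ n : ℕ, TopologicalSpace.induced (SmoothCurve.iterDeriv n) ContinuousMap.compactOpen

instance : TopologicalSpace (SmoothCurve E) :=
  bornologification (SmoothCurve E) (SmoothCurve.compactConvergence E)

end SmoothCurve

/-! ### The space of smooth maps -/

section SmoothMap

section Defs

variable (E F : Type*) [AddCommGroup E] [Module ℝ E] [TopologicalSpace E]
  [AddCommGroup F] [Module ℝ F] [TopologicalSpace F]
  [IsTopologicalAddGroup F] [ContinuousSMul ℝ F] [T2Space F]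

def smoothMaps : Submodule ℝ (E → F) where
  carrier := {f | IsSmoothMap f}
  zero_mem' _ _ := IsSmoothCurve.const 0
  add_mem' hf hg c hc := (hf c hc).add (hg c hc)
  smul_mem' a _ hf c hc := (hf c hc).clm (a • ContinuousLinearMap.id ℝ F)

/-- The vector space `C^∞(E, F)` of smooth maps. -/
def SmoothMap : Type _ := smoothMaps E F

instance : AddCommGroup (SmoothMap E F) := inferInstanceAs (AddCommGroup (smoothMaps E F))
instance : Module ℝ (SmoothMap E F) := inferInstanceAs (Module ℝ (smoothMaps E F))

instance : FunLike (SmoothMap E F) E F where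
  coe f := f.1
  coe_injective _ _ h := Subtype.ext h

variable {E F}

theorem SmoothMap.smooth (f : SmoothMap E F) : IsSmoothMap f := f.2

@[ext]
theorem SmoothMap.ext {f g : SmoothMap E F} (h : ∀ x, f x = g x) : f = g := DFunLike.ext f g h

/-- The map `c^* : C^∞(E, F) → C^∞(ℝ, F)`, `f ↦ f ∘ c`, for a smooth curve `c` in `E`. -/
def SmoothMap.pullCurve {c : ℝ → E} (hc : IsSmoothCurve c) (f : SmoothMap E F) : SmoothCurve F :=
  ⟨f ∘ c, f.smooth c hc⟩

variable (E F)

/-- The initial topology for all the maps `c^* : C^∞(E, F) → C^∞(ℝ, F)`. -/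
@[reducible]
def SmoothMap.initialTopology : TopologicalSpace (SmoothMap E F) :=
  ⨅ (c : ℝ → E) (hc : IsSmoothCurve c),
    TopologicalSpace.induced (SmoothMap.pullCurve hc)
      (inferInstance : TopologicalSpace (SmoothCurve F))

/-- `C^∞(E, F)` carries the bornologification of the initial topology for the maps `c^*`. -/
instance : TopologicalSpace (SmoothMap E F) :=
  bornologification (SmoothMap E F) (SmoothMap.initialTopology E F)

instance : IsTopologicalAddGroup (SmoothMap E F) := bornologification_addGroup _ _
instance : ContinuousSMul ℝ (SmoothMap E F) := bornologification_smul _ _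
instance : LocallyConvexSpace ℝ (SmoothMap E F) := bornologification_lcs _ _

end Defs

variable {E F G : Type*} [AddCommGroup E] [Module ℝ E] [TopologicalSpace E]
  [IsTopologicalAddGroup E] [ContinuousSMul ℝ E] [T2Space E]
  [AddCommGroup F] [Module ℝ F] [TopologicalSpace F]
  [IsTopologicalAddGroup F] [ContinuousSMul ℝ F] [T2Space F]
  [AddCommGroup G] [Module ℝ G] [TopologicalSpace G]
  [IsTopologicalAddGroup G] [ContinuousSMul ℝ G] [T2Space G]

def SmoothCurve.evalLinear (t : ℝ) : SmoothCurve F →ₗ[ℝ] F where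
  toFun c := c.1 t
  map_add' _ _ := rfl
  map_smul' _ _ := rfl

theorem SmoothCurve.continuous_eval [LocallyConvexSpace ℝ F] (t : ℝ) :
    Continuous (SmoothCurve.evalLinear (F := F) t) := by
  refine continuous_bornologification _ (SmoothCurve.compactConvergence F) _ ?_
  have h1 : Continuous[SmoothCurve.compactConvergence F, ContinuousMap.compactOpen]
      (SmoothCurve.iterDeriv (E := F) 0) :=
    continuous_iff_le_induced.2 (iInf_le _ 0)
  exact @Continuous.comp _ _ _ (SmoothCurve.compactConvergence F) _ _
    (SmoothCurve.iterDeriv (E := F) 0) (fun g : C(ℝ, F) => g t)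
    (ContinuousEvalConst.continuous_eval_const t) h1

def SmoothMap.evalLinear (x : E) : SmoothMap E F →ₗ[ℝ] F where
  toFun f := f x
  map_add' _ _ := rfl
  map_smul' _ _ := rfl

theorem SmoothMap.continuous_eval [LocallyConvexSpace ℝ F] (x : E) :
    Continuous (SmoothMap.evalLinear (F := F) x) := by
  refine continuous_bornologification _ (SmoothMap.initialTopology E F) _ ?_
  have h1 : Continuous[SmoothMap.initialTopology E F, (inferInstance : TopologicalSpace (SmoothCurve F))]
      (SmoothMap.pullCurve (F := F) (IsSmoothCurve.const x)) :=
    continuous_iff_le_induced.2 (iInf₂_le _ (IsSmoothCurve.const x))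
  exact @Continuous.comp _ _ _ (SmoothMap.initialTopology E F) _ _
    (SmoothMap.pullCurve (F := F) (IsSmoothCurve.const x)) (SmoothCurve.evalLinear (F := F) 0)
    (SmoothCurve.continuous_eval (F := F) 0) h1

instance [LocallyConvexSpace ℝ F] : T2Space (SmoothMap E F) := by
  have h : Continuous fun (f : SmoothMap E F) (x : E) => f x :=
    continuous_pi fun x => SmoothMap.continuous_eval x
  exact T2Space.of_injective_continuous DFunLike.coe_injective h

def SmoothMap.id : SmoothMap E E := ⟨fun x => x, fun _ hc => hc⟩

def SmoothMap.comp (g : SmoothMap F G) (f : SmoothMap E F) : SmoothMap E G :=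
  ⟨fun x => g (f x), fun c hc => g.smooth _ (f.smooth c hc)⟩

def SmoothMap.fst : SmoothMap (E × F) E :=
  ⟨fun p => p.1, fun _ hc => hc.clm (ContinuousLinearMap.fst ℝ E F)⟩

def SmoothMap.snd : SmoothMap (E × F) F :=
  ⟨fun p => p.2, fun _ hc => hc.clm (ContinuousLinearMap.snd ℝ E F)⟩

/-- The smooth map `x ↦ (f x, g x)`. -/
def SmoothMap.pair (f : SmoothMap E F) (g : SmoothMap E G) : SmoothMap E (F × G) :=
  ⟨fun x => (f x, g x), fun c hc => (f.smooth c hc).prodMk (g.smooth c hc)⟩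

end SmoothMap

/-! ### The category of convenient vector spaces and smooth maps -/

/-- A bundled convenient vector space. -/
structure ConvenientCat : Type (u + 1) where
  carrier : Type u
  [addCommGroup : AddCommGroup carrier]
  [module : Module ℝ carrier]
  [topology : TopologicalSpace carrier]
  [convenient : ConvenientSpace carrier]

namespace ConvenientCat

instance : CoeSort ConvenientCat.{u} (Type u) := ⟨carrier⟩

attribute [instance] addCommGroup module topology convenient

instance : Category.{u} ConvenientCat.{u} where
  Hom E F := SmoothMap E F
  id _ := SmoothMap.id
  comp f g := SmoothMap.comp g f

/-- The product of two convenient vector spaces, with the product topology. -/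
abbrev prod (E F : ConvenientCat.{u}) : ConvenientCat.{u} := ⟨E × F⟩

def terminalCone : Limits.LimitCone (Functor.empty.{0} ConvenientCat.{u}) where
  cone := Limits.asEmptyCone ⟨PUnit.{u + 1}⟩
  isLimit := Limits.IsTerminal.ofUniqueHom
    (fun _ => (⟨fun _ => PUnit.unit, fun _ _ => IsSmoothCurve.const _⟩ : SmoothMap _ _))
    (fun _ _ => rfl)

def prodCone (E F : ConvenientCat.{u}) : Limits.LimitCone (Limits.pair E F) where
  cone := Limits.BinaryFan.mk (P := prod E F) (SmoothMap.fst : SmoothMap (E × F) E)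
    (SmoothMap.snd : SmoothMap (E × F) F)
  isLimit := Limits.BinaryFan.isLimitMk
    (fun s => SmoothMap.pair s.fst s.snd) (fun _ => rfl) (fun _ => rfl)
    (fun s m h1 h2 => by
      exact SmoothMap.ext fun x => Prod.ext
        (DFunLike.congr_fun (F := SmoothMap s.pt E) h1 x)
        (DFunLike.congr_fun (F := SmoothMap s.pt F) h2 x))

/-- The cartesian structure given by the products `E × F` and the zero space. -/
instance : CartesianMonoidalCategory ConvenientCat.{u} :=
  CartesianMonoidalCategory.ofChosenFiniteProducts terminalCone prodCone

end ConvenientCat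

end Convenient

end

/-! A bornologification is controlled through its bounded sets, so convergence in `SmoothMap F G`
cannot be read off derivatives. The proof therefore turns every question into one about boundedness.
By Mackey's theorem boundedness is tested by continuous linear functionals, and bornologification
keeps bounded sets bounded; hence a set of smooth maps is bounded exactly when all scalar jets (L ∘
f ∘ c)⁽ⁿ⁾ are uniformly bounded on compact intervals (`SmoothMap.isVonNBounded_iff`).

Mackey completeness turns bounds back into limits. If the second divided differences of a curve are
locally bounded, its difference quotients are Mackey-Cauchy and the curve is differentiable.
Consequently weakly smooth curves are smooth (`isSmoothCurve_of_contDiff_clm`). Spaces of smooth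
maps are convenient because a Mackey-Cauchy sequence has a limit in the sense of jets, and the
bounds on rescaled differences survive passage to that limit.

For currying, compose f with curves in both variables and with a functional. Boman's theorem makes
the result a smooth function on ℝ², so its second derivatives are bounded on compact sets; this
bounds the divided differences of t ↦ f(t, ·). The derivative of that curve has the same form, and
induction gives smoothness. Uncurrying differentiates jets along the diagonal by a product rule.
Smoothness of Φ and its inverse is the exponential law again, with ℝ as an extra factor.

Boman's theorem is proved by Fourier analysis: curves through fast converging points show that
iterated directional derivatives are locally bounded, so after a cutoff the Fourier transform decays
rapidly, and inversion gives smoothness. -/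

namespace Convenient

open scoped ContDiff FourierTransform RealInnerProductSpace

/-! ### Boman's theorem -/

section Boman

/-- A bounded common estimate for finitely many derivatives of a compactly supported function. -/
theorem exists_bound_iteratedFDeriv {g : ℝ → ℝ} (hg : ContDiff ℝ ∞ g) (hs : HasCompactSupport g)
    (N : ℕ) : ∃ C : ℝ, 0 ≤ C ∧ ∀ n ≤ N, ∀ t, ‖iteratedFDeriv ℝ n g t‖ ≤ C := by
  have h : ∀ n : ℕ, ∃ C : ℝ, ∀ t, ‖iteratedFDeriv ℝ n g t‖ ≤ C := fun n =>
    (hs.iteratedFDeriv n).exists_bound_of_continuous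
      (hg.continuous_iteratedFDeriv (by exact_mod_cast le_top))
  choose C hC using h
  refine ⟨∑ n ∈ Finset.range (N + 1), |C n|, Finset.sum_nonneg fun _ _ => abs_nonneg _,
    fun n hn t => (hC n t).trans ((le_abs_self _).trans ?_)⟩
  exact Finset.single_le_sum (f := fun n => |C n|) (fun _ _ => abs_nonneg _)
    (Finset.mem_range.2 (by omega))

variable {V : Type*} [NormedAddCommGroup V] [NormedSpace ℝ V]

theorem norm_iteratedFDeriv_smul_const_le {g : ℝ → ℝ} (hg : ContDiff ℝ ∞ g) (x : V) (n : ℕ)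
    (t : ℝ) : ‖iteratedFDeriv ℝ n (fun t => g t • x) t‖ ≤ ‖iteratedFDeriv ℝ n g t‖ * ‖x‖ := by
  have h := ContinuousLinearMap.norm_iteratedFDeriv_comp_left
    (ContinuousLinearMap.toSpanSingleton ℝ x) (f := g) (x := t) (N := ∞) (n := n)
    hg.contDiffAt (by exact_mod_cast le_top)
  have h2 : (ContinuousLinearMap.toSpanSingleton ℝ x : ℝ → V) ∘ g = fun t => g t • x := by
    ext; simp
  rw [h2, ContinuousLinearMap.norm_toSpanSingleton, mul_comm] at h
  exact h

/-- Smooth curves through fast converging sequences with prescribed fast converging velocities: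
the general curve lemma. -/
theorem exists_curve_through [CompleteSpace V] :
    ∃ (a s : ℕ → ℝ), (∀ k, 0 < a k) ∧ Tendsto s atTop (𝓝 0) ∧
    ∀ x v : ℕ → V, (∀ k, ‖x k‖ ≤ a k) → (∀ k, ‖v k‖ ≤ a k) →
      ∃ c : ℝ → V, ContDiff ℝ ∞ c ∧ c 0 = 0 ∧
        ∀ k, ∀ᶠ t in 𝓝 (s k), c t = x k + (t - s k) • v k := by
  let s : ℕ → ℝ := fun k => (1 / 2) ^ k
  have hs0 : ∀ k, 0 < s k := fun k => by positivity
  let β : ∀ k, ContDiffBump (s k) := fun k =>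
    ⟨s k / 8, s k / 4, by have := hs0 k; positivity, by have := hs0 k; linarith⟩
  have hβ : ∀ k, ContDiff ℝ ∞ (β k) := fun k => (β k).contDiff
  have hβs : ∀ k, HasCompactSupport (β k) := fun k => (β k).hasCompactSupport
  have hγ : ∀ k, ContDiff ℝ ∞ (fun t => β k t * (t - s k)) := fun k =>
    (hβ k).mul (contDiff_id.sub contDiff_const)
  have hγs : ∀ k, HasCompactSupport (fun t => β k t * (t - s k)) := fun k =>
    (hβs k).mul_right
  -- The bounds for index k cover only orders up to k. This suffices, since a derivative of fixed
  -- order n only needs control for k ≥ n.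
  choose C hC0 hC using fun k => exists_bound_iteratedFDeriv (hβ k) (hβs k) k
  choose D hD0 hD using fun k => exists_bound_iteratedFDeriv (hγ k) (hγs k) k
  have hCD : ∀ k, 0 < C k + D k + 1 := fun k => by linarith [hC0 k, hD0 k]
  -- Dividing by the bump bounds makes the k-th summand at most 2⁻ᵏ in every order up to k. The
  -- radii do not depend on `x` and `v`, so these can be chosen afterwards.
  refine ⟨fun k => (1 / 2) ^ k / (C k + D k + 1), s, fun k => div_pos (by positivity) (hCD k),
    tendsto_pow_atTop_nhds_zero_of_lt_one (by norm_num) (by norm_num), fun x v hx hv => ?_⟩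
  let f : ℕ → ℝ → V := fun k t => β k t • x k + (β k t * (t - s k)) • v k
  have hfc : ∀ k, ContDiff ℝ ∞ (f k) := fun k =>
    ((hβ k).smul contDiff_const).add ((hγ k).smul contDiff_const)
  have hf0 : ∀ k t, s k / 4 ≤ |t - s k| → f k t = 0 := fun k t ht => by
    have : β k t = 0 := (β k).zero_of_le_dist (by simpa [β, Real.dist_eq] using ht)
    simp [f, this]
  have hf1 : ∀ k t, |t - s k| ≤ s k / 8 → f k t = x k + (t - s k) • v k := fun k t ht => by
    have : β k t = 1 := (β k).one_of_mem_closedBall (by simpa [β, Real.dist_eq] using ht)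
    simp [f, this]
  refine ⟨fun t => ∑' k, f k t, ?_, ?_, fun k => ?_⟩
  · refine contDiff_tsum_of_eventually (N := (⊤ : ℕ∞)) (v := fun _ k => (1 / 2 : ℝ) ^ k) hfc
      (fun _ _ => summable_geometric_two) fun n _ => ?_
    rw [Nat.cofinite_eq_atTop]
    filter_upwards [eventually_ge_atTop n] with k hk t
    have e : f k = (fun t => β k t • x k) + fun t => (β k t * (t - s k)) • v k := rfl
    have h1 : ContDiff ℝ n (fun t => β k t • x k) :=
      ((hβ k).smul contDiff_const).of_le (by exact_mod_cast le_top)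
    have h2 : ContDiff ℝ n (fun t => (β k t * (t - s k)) • v k) :=
      ((hγ k).smul contDiff_const).of_le (by exact_mod_cast le_top)
    rw [e, iteratedFDeriv_add_apply h1.contDiffAt h2.contDiffAt]
    calc _ ≤ _ := norm_add_le _ _
      _ ≤ ‖iteratedFDeriv ℝ n (β k) t‖ * ‖x k‖ +
          ‖iteratedFDeriv ℝ n (fun t => β k t * (t - s k)) t‖ * ‖v k‖ :=
        add_le_add (norm_iteratedFDeriv_smul_const_le (hβ k) _ _ _)
          (norm_iteratedFDeriv_smul_const_le (hγ k) _ _ _)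
      _ ≤ C k * ((1 / 2) ^ k / (C k + D k + 1)) + D k * ((1 / 2) ^ k / (C k + D k + 1)) := by
        gcongr
        · exact hC0 k
        · exact hC k n hk t
        · exact hx k
        · exact hD0 k
        · exact hD k n hk t
        · exact hv k
      _ = (C k + D k) / (C k + D k + 1) * (1 / 2) ^ k := by ring
      _ ≤ 1 * (1 / 2) ^ k := by
        gcongr
        rw [div_le_one (hCD k)]
        linarith
      _ = _ := one_mul _
  · have : ∀ k, f k 0 = 0 := fun k => hf0 k 0 (by
      rw [zero_sub, abs_neg, abs_of_pos (hs0 k)]; linarith [hs0 k])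
    simp [this]
  · have : Metric.ball (s k) (s k / 8) ∈ 𝓝 (s k) :=
      Metric.ball_mem_nhds _ (by have := hs0 k; positivity)
    filter_upwards [this] with t ht
    rw [Metric.mem_ball, Real.dist_eq] at ht
    rw [← hf1 k t ht.le]
    refine tsum_eq_single k fun j hj => hf0 j t ?_
    -- Later nodes are at most half of earlier ones, so the bumps of radius `s k / 4` do not meet
    -- the plateau around `s k` of another index.
    have hsucc : ∀ i j, i < j → s j ≤ s i / 2 := fun i j hij => by
      have h1 : s j ≤ s (i + 1) :=
        pow_le_pow_of_le_one (by norm_num) (by norm_num) hij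
      have h2 : s (i + 1) = s i / 2 := by simp only [s, pow_succ]; ring
      linarith
    have hk := hs0 k
    have hj' := hs0 j
    rw [abs_lt] at ht
    rcases lt_or_gt_of_ne hj with h | h
    · have := hsucc j k h
      rw [abs_sub_comm]
      refine le_trans ?_ (le_abs_self _)
      linarith
    · have := hsucc k j h
      refine le_trans ?_ (le_abs_self _)
      linarith

theorem iteratedDeriv_comp_affine {f : ℝ → ℝ} {n : ℕ} (h : ContDiff ℝ n f) (b s t : ℝ) :
    iteratedDeriv n (fun t => f ((t - s) * b)) t = b ^ n * iteratedDeriv n f ((t - s) * b) := by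
  have h1 := iteratedDeriv_comp_sub_const n (fun t => f (t * b)) s
  have h2 := iteratedDeriv_comp_const_mul h b
  simp only [mul_comm b] at h2
  have := congrFun h1 t
  rw [this, congrFun h2 (t - s)]

variable {f : V → ℝ}

/-- A discontinuity at x would supply points converging to x arbitrarily fast with values staying
away from f(x); a smooth curve through them contradicts continuity along curves. -/
theorem continuous_of_comp_curve [CompleteSpace V]
    (hf : ∀ c : ℝ → V, ContDiff ℝ ∞ c → ContDiff ℝ ∞ (f ∘ c)) : Continuous f := by
  rw [continuous_iff_continuousAt]
  intro x
  by_contra hx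
  rw [ContinuousAt, Metric.tendsto_nhds] at hx
  push Not at hx
  obtain ⟨ε, hε, hx⟩ := hx
  obtain ⟨a, s, ha, hs, H⟩ := exists_curve_through (V := V)
  have : ∀ k, ∃ y, ‖y - x‖ ≤ a k ∧ ε ≤ dist (f y) (f x) := fun k => by
    obtain ⟨y, hy1, hy2⟩ := (hx.and_eventually (Metric.closedBall_mem_nhds x (ha k))).exists
    exact ⟨y, by simpa [dist_eq_norm] using hy2, hy1⟩
  choose y hy1 hy2 using this
  obtain ⟨c, hc, hc0, hcs⟩ := H (fun k => y k - x) 0 hy1 (fun k => by simpa using (ha k).le)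
  have h1 : Tendsto (fun k => f (x + c (s k))) atTop (𝓝 (f (x + c 0))) :=
    ((hf _ (contDiff_const.add hc)).continuous.tendsto 0).comp hs
  have h2 : ∀ k, f (x + c (s k)) = f (y k) := fun k => by
    rw [(hcs k).self_of_nhds]; simp
  simp only [h2, hc0, add_zero] at h1
  obtain ⟨k, hk⟩ := ((Metric.tendsto_nhds.1 h1) ε hε).exists
  exact absurd (hy2 k) (not_le.2 hk)

theorem contDiff_comp_line (hf : ∀ c : ℝ → V, ContDiff ℝ ∞ c → ContDiff ℝ ∞ (f ∘ c))
    (x v : V) : ContDiff ℝ ∞ (fun t : ℝ => f (x + t • v)) :=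
  hf (fun t => x + t • v) (contDiff_const.add (contDiff_id.smul contDiff_const))

/-- Iterated directional derivatives are locally bounded. -/
theorem locally_bounded_iteratedDeriv_line [CompleteSpace V]
    (hf : ∀ c : ℝ → V, ContDiff ℝ ∞ c → ContDiff ℝ ∞ (f ∘ c)) (v : V) (n : ℕ) (x : V) :
    ∃ M : ℝ, ∀ᶠ y in 𝓝 x, |iteratedDeriv n (fun t : ℝ => f (y + t • v)) 0| ≤ M := by
  by_contra hx
  push Not at hx
  obtain ⟨a, s, ha, hs, H⟩ := exists_curve_through (V := V)
  -- The velocity `b k • v` has norm at most `a k`. Near `s k` the curve is affine, so the n-th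
  -- derivative of f along it is `b k ^ n` times the directional one; the threshold `k / b k ^ n`
  -- makes it exceed k, against continuity at 0.
  let b : ℕ → ℝ := fun k => a k / (‖v‖ + 1)
  have hb : ∀ k, 0 < b k := fun k => div_pos (ha k) (by positivity)
  have : ∀ k : ℕ, ∃ y, ‖y - x‖ ≤ a k ∧
      k / b k ^ n < |iteratedDeriv n (fun t : ℝ => f (y + t • v)) 0| := fun k => by
    obtain ⟨y, hy1, hy2⟩ := ((hx (k / b k ^ n)).and_eventually
      (Metric.closedBall_mem_nhds x (ha k))).exists
    exact ⟨y, by simpa [dist_eq_norm] using hy2, hy1⟩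
  choose y hy1 hy2 using this
  obtain ⟨c, hc, hc0, hcs⟩ := H (fun k => y k - x) (fun k => b k • v) hy1 (fun k => by
    rw [norm_smul, Real.norm_of_nonneg (hb k).le, div_mul_eq_mul_div, div_le_iff₀ (by positivity)]
    nlinarith [ha k, norm_nonneg v])
  have hsm : ContDiff ℝ ∞ (fun t => f (x + c t)) := hf _ (contDiff_const.add hc)
  have h1 : Tendsto (fun k => iteratedDeriv n (fun t => f (x + c t)) (s k)) atTop
      (𝓝 (iteratedDeriv n (fun t => f (x + c t)) 0)) :=
    ((hsm.continuous_iteratedDeriv n (by exact_mod_cast le_top)).tendsto 0).comp hs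
  have h2 : ∀ k, iteratedDeriv n (fun t => f (x + c t)) (s k) =
      b k ^ n * iteratedDeriv n (fun t : ℝ => f (y k + t • v)) 0 := fun k => by
    have e : (fun t => f (x + c t)) =ᶠ[𝓝 (s k)]
        (fun t => (fun t : ℝ => f (y k + t • v)) ((t - s k) * b k)) := by
      filter_upwards [hcs k] with t ht
      rw [ht, mul_smul]
      congr 1
      abel
    rw [e.iteratedDeriv_eq, iteratedDeriv_comp_affine
      ((contDiff_comp_line hf (y k) v).of_le (by exact_mod_cast le_top))]
    simp
  obtain ⟨K, hK⟩ := h1.norm.bddAbove_range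
  obtain ⟨k, hk⟩ := exists_nat_gt K
  have h3 := hK ⟨k, rfl⟩
  simp only [h2, norm_mul, Real.norm_eq_abs, abs_pow, abs_of_pos (hb k)] at h3
  have h4 := hy2 k
  rw [div_lt_iff₀ (pow_pos (hb k) n)] at h4
  linarith

end Boman

/-! ### Directional derivatives and rapid decay of the Fourier transform -/

section Fourier

variable {V : Type*} [NormedAddCommGroup V] [NormedSpace ℝ V] {f : V → ℝ}

/-- The `n`-th iterated directional derivative of `f` in direction `v`. -/
noncomputable def lineDerivIter (f : V → ℝ) (v : V) (n : ℕ) (x : V) : ℝ :=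
  iteratedDeriv n (fun t : ℝ => f (x + t • v)) 0

theorem lineDerivIter_add_smul (f : V → ℝ) (v : V) (n : ℕ) (x : V) (t : ℝ) :
    lineDerivIter f v n (x + t • v) = iteratedDeriv n (fun t : ℝ => f (x + t • v)) t := by
  have h := congrFun (iteratedDeriv_comp_const_add n (fun s : ℝ => f (x + s • v)) t) 0
  rw [add_zero] at h
  rw [← h]
  simp only [lineDerivIter, add_smul, add_assoc]

theorem hasLineDerivAt_lineDerivIter
    (hf : ∀ c : ℝ → V, ContDiff ℝ ∞ c → ContDiff ℝ ∞ (f ∘ c)) (v : V) (n : ℕ) (x : V) :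
    HasLineDerivAt ℝ (lineDerivIter f v n) (lineDerivIter f v (n + 1) x) x v := by
  have h := (contDiff_comp_line hf x v).differentiable_iteratedDeriv n
    (by exact_mod_cast WithTop.coe_lt_top n)
  have h2 := (h 0).hasDerivAt
  rw [← iteratedDeriv_succ] at h2
  simp only [HasLineDerivAt, lineDerivIter_add_smul]
  exact h2

theorem lineDerivIter_eq_zero {v : V} {n : ℕ} {x : V} (hx : x ∉ tsupport f) :
    lineDerivIter f v n x = 0 := by
  have h1 : Tendsto (fun t : ℝ => x + t • v) (𝓝 0) (𝓝 x) := by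
    have : Continuous (fun t : ℝ => x + t • v) := by fun_prop
    simpa using this.tendsto 0
  have h2 : (fun t : ℝ => f (x + t • v)) =ᶠ[𝓝 0] fun _ => 0 :=
    h1.eventually (notMem_tsupport_iff_eventuallyEq.1 hx)
  rw [lineDerivIter, h2.iteratedDeriv_eq]
  simp

theorem exists_bound_lineDerivIter [CompleteSpace V]
    (hf : ∀ c : ℝ → V, ContDiff ℝ ∞ c → ContDiff ℝ ∞ (f ∘ c)) (hs : HasCompactSupport f)
    (v : V) (n : ℕ) : ∃ M : ℝ, ∀ x, |lineDerivIter f v n x| ≤ M := by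
  have : ∃ M : ℝ, ∀ x ∈ tsupport f, |lineDerivIter f v n x| ≤ M := by
    refine IsCompact.induction_on (p := fun s => ∃ M : ℝ, ∀ x ∈ s, |lineDerivIter f v n x| ≤ M)
      hs ⟨0, by simp⟩ (fun s t hst ⟨M, hM⟩ => ⟨M, fun x hx => hM x (hst hx)⟩) ?_ ?_
    · rintro s t ⟨M, hM⟩ ⟨N, hN⟩
      exact ⟨max M N, fun x hx => hx.elim (fun h => (hM x h).trans (le_max_left _ _))
        (fun h => (hN x h).trans (le_max_right _ _))⟩
    · intro x _
      obtain ⟨M, hM⟩ := locally_bounded_iteratedDeriv_line hf v n x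
      exact ⟨_, mem_nhdsWithin_of_mem_nhds hM, M, fun y hy => hy⟩
  obtain ⟨M, hM⟩ := this
  refine ⟨max M 0, fun x => ?_⟩
  by_cases hx : x ∈ tsupport f
  · exact (hM x hx).trans (le_max_left _ _)
  · rw [lineDerivIter_eq_zero hx]
    simp

/-- Each derivative is a pointwise limit of difference quotients of the previous one. Joint
continuity is not yet known, but measurability and boundedness are enough for integration. -/
theorem measurable_lineDerivIter [CompleteSpace V] [MeasurableSpace V] [BorelSpace V]
    (hf : ∀ c : ℝ → V, ContDiff ℝ ∞ c → ContDiff ℝ ∞ (f ∘ c)) (v : V) (n : ℕ) :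
    Measurable (lineDerivIter f v n) := by
  induction n with
  | zero =>
    have : lineDerivIter f v 0 = f := by
      ext x; simp [lineDerivIter]
    rw [this]
    exact (continuous_of_comp_curve hf).measurable
  | succ n ih =>
    let ε : ℕ → ℝ := fun k => 1 / ((k : ℝ) + 1)
    have hε : Tendsto ε atTop (𝓝[≠] 0) := tendsto_nhdsWithin_iff.2
      ⟨tendsto_one_div_add_atTop_nhds_zero_nat, Eventually.of_forall fun k => by
        simp only [mem_compl_iff, mem_singleton_iff, ε]; positivity⟩
    refine measurable_of_tendsto_metrizable (f := fun k x =>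
      (ε k)⁻¹ • (lineDerivIter f v n (x + ε k • v) - lineDerivIter f v n x)) (fun k => ?_) ?_
    · exact ((ih.comp (measurable_add_const (ε k • v))).sub ih).const_smul (ε k)⁻¹
    · rw [tendsto_pi_nhds]
      intro x
      have h := (hasLineDerivAt_lineDerivIter hf v n x).tendsto_slope_zero
      exact h.comp hε

variable {V : Type*} [NormedAddCommGroup V] [InnerProductSpace ℝ V] {f : V → ℝ}
  [FiniteDimensional ℝ V] [MeasurableSpace V] [BorelSpace V]

open MeasureTheory

theorem integrable_lineDerivIter
    (hf : ∀ c : ℝ → V, ContDiff ℝ ∞ c → ContDiff ℝ ∞ (f ∘ c)) (hs : HasCompactSupport f)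
    (v : V) (n : ℕ) : Integrable (lineDerivIter f v n) := by
  have : CompleteSpace V := FiniteDimensional.complete ℝ V
  obtain ⟨M, hM⟩ := exists_bound_lineDerivIter hf hs v n
  rw [← integrableOn_iff_integrable_of_support_subset (s := tsupport f)
    (fun x hx => by_contra fun h => hx (lineDerivIter_eq_zero h))]
  exact Measure.integrableOn_of_bounded hs.measure_lt_top.ne
    (measurable_lineDerivIter hf v n).aestronglyMeasurable (M := M)
    (Eventually.of_forall fun x => hM x)

/-- Integration by parts in direction v against the exponential, valid because all products involved
are integrable. -/
theorem fourier_lineDerivIter_succ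
    (hf : ∀ c : ℝ → V, ContDiff ℝ ∞ c → ContDiff ℝ ∞ (f ∘ c)) (hs : HasCompactSupport f)
    (v : V) (n : ℕ) (ξ : V) :
    𝓕 (fun x => (lineDerivIter f v (n + 1) x : ℂ)) ξ =
      (2 * Real.pi * ⟪v, ξ⟫ : ℝ) * Complex.I * 𝓕 (fun x => (lineDerivIter f v n x : ℂ)) ξ := by
  let e : V → ℂ := fun x => Complex.exp (↑(-2 * Real.pi * ⟪x, ξ⟫) * Complex.I)
  have hec : Continuous e := by fun_prop
  have hen : ∀ x, ‖e x‖ = 1 := fun x => Complex.norm_exp_ofReal_mul_I _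
  let a : ℂ := -((2 * Real.pi * ⟪v, ξ⟫ : ℝ) * Complex.I)
  have hint : ∀ m (b : ℂ), Integrable (fun x => (lineDerivIter f v m x : ℂ) * (b * e x)) := fun m b =>
    ((integrable_lineDerivIter hf hs v m).ofReal).mul_bdd (c := ‖b‖)
      (hec.const_smul b).aestronglyMeasurable (Eventually.of_forall fun x => by simp [hen])
  have he : ∀ x, HasLineDerivAt ℝ e (a * e x) x v := fun x => by
    have h1 : HasDerivAt (fun t : ℝ => (↑(-2 * Real.pi * ⟪x + t • v, ξ⟫) * Complex.I : ℂ)) a 0 := by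
      have : (fun t : ℝ => (↑(-2 * Real.pi * ⟪x + t • v, ξ⟫) * Complex.I : ℂ)) =
          fun t : ℝ => (↑(-2 * Real.pi * ⟪x, ξ⟫) * Complex.I : ℂ) + t * a := by
        ext t
        simp only [a, inner_add_left, real_inner_smul_left]
        push_cast
        ring
      rw [this]
      simpa using ((Complex.ofRealCLM.hasDerivAt (x := 0)).mul_const a).const_add
        (↑(-2 * Real.pi * ⟪x, ξ⟫) * Complex.I : ℂ)
    have h2 := h1.cexp
    rw [HasLineDerivAt]
    simpa [e, mul_comm] using h2
  have hg : ∀ x, HasLineDerivAt ℝ (fun x => (lineDerivIter f v n x : ℂ))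
      (lineDerivIter f v (n + 1) x : ℂ) x v := fun x =>
    HasDerivAt.ofReal_comp (hasLineDerivAt_lineDerivIter hf v n x)
  have key := integral_bilinear_hasLineDerivAt_right_eq_neg_left_of_integrable
    (μ := (volume : Measure V)) (B := ContinuousLinearMap.mul ℝ ℂ)
    (f := fun x => (lineDerivIter f v n x : ℂ))
    (f' := fun x => (lineDerivIter f v (n + 1) x : ℂ)) (g := e) (g' := fun x => a * e x) (v := v)
    (by simpa using hint (n + 1) 1) (by simpa using hint n a) (by simpa using hint n 1)
    (fun x _ => hg x) (fun x _ => he x)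
  simp only [ContinuousLinearMap.mul_apply'] at key
  rw [Real.fourier_eq', Real.fourier_eq']
  have e1 : ∀ m, ∫ x, Complex.exp (↑(-2 * Real.pi * ⟪x, ξ⟫) * Complex.I) •
      (lineDerivIter f v m x : ℂ) = ∫ x, (lineDerivIter f v m x : ℂ) * e x := fun m => by
    simp only [smul_eq_mul, e, mul_comm]
  rw [e1, e1, ← neg_eq_iff_eq_neg.2 key, ← integral_const_mul, ← integral_neg]
  congr 1
  ext x
  simp only [a]
  ring

theorem fourier_lineDerivIter
    (hf : ∀ c : ℝ → V, ContDiff ℝ ∞ c → ContDiff ℝ ∞ (f ∘ c)) (hs : HasCompactSupport f)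
    (v : V) (n : ℕ) (ξ : V) :
    𝓕 (fun x => (lineDerivIter f v n x : ℂ)) ξ =
      ((2 * Real.pi * ⟪v, ξ⟫ : ℝ) * Complex.I) ^ n * 𝓕 (fun x => (f x : ℂ)) ξ := by
  induction n with
  | zero => simp [lineDerivIter]
  | succ n ih => rw [fourier_lineDerivIter_succ hf hs, ih, pow_succ']; ring

/-- The transform of an n-th directional derivative is bounded by an L¹ norm, which controls |⟪v,
ξ⟫|ⁿ times the transform. Orthonormal basis directions suffice: the norm of ξ is at most the
dimension times its largest coordinate. -/
theorem fourier_decay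
    (hf : ∀ c : ℝ → V, ContDiff ℝ ∞ c → ContDiff ℝ ∞ (f ∘ c)) (hs : HasCompactSupport f)
    (n : ℕ) : ∃ C : ℝ, ∀ ξ, ‖ξ‖ ^ n * ‖𝓕 (fun x => (f x : ℂ)) ξ‖ ≤ C := by
  have h1 : ∀ v : V, ∃ C : ℝ, ∀ ξ, |⟪v, ξ⟫| ^ n * ‖𝓕 (fun x => (f x : ℂ)) ξ‖ ≤ C := fun v => by
    refine ⟨∫ x, ‖(lineDerivIter f v n x : ℂ)‖, fun ξ => ?_⟩
    have h2 : ‖𝓕 (fun x => (lineDerivIter f v n x : ℂ)) ξ‖ ≤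
        ∫ x, ‖(lineDerivIter f v n x : ℂ)‖ :=
      VectorFourier.norm_fourierIntegral_le_integral_norm _ _ _ _ _
    refine le_trans ?_ h2
    rw [fourier_lineDerivIter hf hs, norm_mul, norm_pow, norm_mul, Complex.norm_I, mul_one,
      Complex.norm_real, Real.norm_eq_abs, abs_mul, abs_of_pos Real.two_pi_pos]
    gcongr
    exact le_mul_of_one_le_left (abs_nonneg _) (by linarith [Real.pi_gt_three])
  choose C hC using h1
  let b := stdOrthonormalBasis ℝ V
  have hb : ∀ ξ : V, ‖ξ‖ ≤ ∑ i, |⟪b i, ξ⟫| := fun ξ => by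
    conv_lhs => rw [← b.sum_repr' ξ]
    exact (norm_sum_le _ _).trans (by simp [norm_smul])
  -- In dimension zero there is no largest coordinate, but ξ = 0 is the only frequency.
  rcases isEmpty_or_nonempty (Fin (Module.finrank ℝ V)) with h | h
  · refine ⟨‖(0 : V)‖ ^ n * ‖𝓕 (fun x => (f x : ℂ)) 0‖, fun ξ => ?_⟩
    have : ξ = 0 := by simpa using hb ξ
    rw [this]
  · refine ⟨(Fintype.card (Fin (Module.finrank ℝ V)) : ℝ) ^ n * ∑ i, |C (b i)|, fun ξ => ?_⟩
    obtain ⟨i, -, hi⟩ := Finset.exists_max_image Finset.univ (fun i => |⟪b i, ξ⟫|)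
      Finset.univ_nonempty
    have h3 : ‖ξ‖ ≤ Fintype.card (Fin (Module.finrank ℝ V)) * |⟪b i, ξ⟫| := by
      refine (hb ξ).trans ((Finset.sum_le_card_nsmul _ _ _ hi).trans (by simp))
    calc _ ≤ (Fintype.card (Fin (Module.finrank ℝ V)) * |⟪b i, ξ⟫|) ^ n *
          ‖𝓕 (fun x => (f x : ℂ)) ξ‖ := by gcongr
      _ = (Fintype.card (Fin (Module.finrank ℝ V)) : ℝ) ^ n *
          (|⟪b i, ξ⟫| ^ n * ‖𝓕 (fun x => (f x : ℂ)) ξ‖) := by ring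
      _ ≤ _ := by
        gcongr
        exact (hC (b i) ξ).trans ((le_abs_self _).trans (Finset.single_le_sum
          (f := fun i => |C (b i)|) (fun _ _ => abs_nonneg _) (Finset.mem_univ i)))

theorem contDiff_of_comp_curve_of_hasCompactSupport
    (hf : ∀ c : ℝ → V, ContDiff ℝ ∞ c → ContDiff ℝ ∞ (f ∘ c)) (hs : HasCompactSupport f) :
    ContDiff ℝ ∞ f := by
  have : CompleteSpace V := FiniteDimensional.complete ℝ V
  have hcont := continuous_of_comp_curve hf
  let F : V → ℂ := fun x => f x
  have hF : Continuous F := Complex.continuous_ofReal.comp hcont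
  have hFi : Integrable F := (hcont.integrable_of_hasCompactSupport hs).ofReal
  have hFc : Continuous (𝓕 F) :=
    VectorFourier.fourierIntegral_continuous Real.continuous_fourierChar
      (continuous_inner) hFi
  have hint : ∀ k : ℕ, Integrable (fun ξ => ‖ξ‖ ^ k * ‖𝓕 F ξ‖) := fun k => by
    obtain ⟨C₁, h₁⟩ := fourier_decay hf hs 0
    -- The additional power makes ‖ξ‖ᵏ times the transform integrable at infinity.
    obtain ⟨C₂, h₂⟩ := fourier_decay hf hs (k + (volume : Measure V).integrablePower)
    exact integrable_of_le_of_pow_mul_le (fun ξ => by simpa using h₁ ξ) h₂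
      hFc.aestronglyMeasurable
  have hFi' : Integrable (𝓕 F) := by
    rw [← integrable_norm_iff hFc.aestronglyMeasurable]
    simpa using hint 0
  have h1 : ContDiff ℝ ∞ (𝓕 (𝓕 F)) := Real.contDiff_fourier (N := ⊤) fun n _ => hint n
  have h2 : F = fun x => 𝓕 (𝓕 F) (-x) := by
    conv_lhs => rw [← hF.fourierInv_fourier_eq hFi hFi']
    ext x
    rw [Real.fourierInv_eq_fourier_neg]
  have h3 : f = fun x => (𝓕 (𝓕 F) (-x)).re := by
    ext x
    rw [← congrFun h2 x]
    simp [F]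
  rw [h3]
  exact Complex.reCLM.contDiff.comp (h1.comp contDiff_neg)

end Fourier

/-- **Boman's theorem**: a real function on a finite-dimensional space that is smooth along all
smooth curves is smooth. -/
theorem contDiff_of_comp_curve {V : Type*} [NormedAddCommGroup V] [InnerProductSpace ℝ V]
    [FiniteDimensional ℝ V] {f : V → ℝ}
    (hf : ∀ c : ℝ → V, ContDiff ℝ ∞ c → ContDiff ℝ ∞ (f ∘ c)) : ContDiff ℝ ∞ f := by
  borelize V
  rw [contDiff_iff_contDiffAt]
  intro x
  -- A cutoff equal to 1 near x preserves smoothness along curves and reduces to compact support.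
  let β : ContDiffBump x := ⟨1, 2, one_pos, one_lt_two⟩
  have h1 : ContDiff ℝ ∞ (fun y => β y * f y) := by
    refine contDiff_of_comp_curve_of_hasCompactSupport (fun c hc => ?_) β.hasCompactSupport.mul_right
    exact (β.contDiff.comp hc).mul (hf c hc)
  refine h1.contDiffAt.congr_of_eventuallyEq ?_
  filter_upwards [β.eventuallyEq_one] with y hy
  simp [hy]

/-- Boman's theorem for functions of two real variables. -/
theorem contDiff_of_comp_curve_prod {f : ℝ × ℝ → ℝ}
    (hf : ∀ a b : ℝ → ℝ, ContDiff ℝ ∞ a → ContDiff ℝ ∞ b →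
      ContDiff ℝ ∞ (fun t => f (a t, b t))) : ContDiff ℝ ∞ f := by
  -- ℝ × ℝ carries the sup norm, so the Euclidean version is used.
  let L := WithLp.prodContinuousLinearEquiv 2 ℝ ℝ ℝ
  have h : ContDiff ℝ ∞ (f ∘ L) := contDiff_of_comp_curve fun c hc => by
    have h2 : ContDiff ℝ ∞ (L ∘ c) := L.contDiff.comp hc
    exact hf (fun t => (L (c t)).1) (fun t => (L (c t)).2) h2.fst h2.snd
  have h3 : f = (f ∘ L) ∘ L.symm := by ext x; simp
  rw [h3]
  exact h.comp L.symm.contDiff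

/-! ### Smooth curves in locally convex spaces -/

/-! ### Mackey's theorem on weakly bounded sets -/

section WeakBoundedness

/-- Banach-Steinhaus applied to the points of B as functionals on the dual, followed by a norming
functional from Hahn-Banach. -/
theorem exists_norm_le_of_weakly_bounded {V : Type*} [SeminormedAddCommGroup V] [NormedSpace ℝ V]
    {B : Set V} (h : ∀ L : V →ₗ[ℝ] ℝ, (∃ C, ∀ x, |L x| ≤ C * ‖x‖) → ∃ M, ∀ x ∈ B, |L x| ≤ M) :
    ∃ M, ∀ x ∈ B, ‖x‖ ≤ M := by
  obtain ⟨C, hC⟩ := banach_steinhaus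
    (g := fun x : B => NormedSpace.inclusionInDoubleDual ℝ V x) fun L => by
      obtain ⟨M, hM⟩ := h L.toLinearMap ⟨_, L.le_opNorm⟩
      exact ⟨M, fun x => by simpa using hM x x.2⟩
  refine ⟨C, fun x hx => ?_⟩
  obtain ⟨L, hL1, hL2⟩ := exists_dual_vector'' ℝ x
  have h1 := (NormedSpace.inclusionInDoubleDual ℝ V x).le_opNorm L
  rw [NormedSpace.dual_def, hL2] at h1
  have h2 := hC ⟨x, hx⟩
  calc ‖x‖ ≤ _ := by simpa using h1
    _ ≤ C * 1 := mul_le_mul h2 hL1 (norm_nonneg _) ((norm_nonneg _).trans h2)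
    _ = C := mul_one C

theorem exists_bound_of_isVonNBounded {E : Type*} [AddCommGroup E] [Module ℝ E]
    [TopologicalSpace E] {B : Set E} (hB : IsVonNBounded ℝ B) (L : E →L[ℝ] ℝ) :
    ∃ M, ∀ x ∈ B, |L x| ≤ M := by
  have := (hB.image L)
  rw [NormedSpace.isVonNBounded_iff, isBounded_iff_forall_norm_le] at this
  obtain ⟨M, hM⟩ := this
  exact ⟨M, fun x hx => hM _ (mem_image_of_mem L hx)⟩

variable {E : Type*} [AddCommGroup E] [Module ℝ E] [TopologicalSpace E]
  [IsTopologicalAddGroup E]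

theorem exists_seminorm_le_of_weakly_bounded {p : Seminorm ℝ E} (hp : Continuous p) {B : Set E}
    (h : ∀ L : E →L[ℝ] ℝ, ∃ M, ∀ x ∈ B, |L x| ≤ M) : ∃ M, ∀ x ∈ B, p x ≤ M := by
  -- With p as its seminorm, every functional bounded by a multiple of p is continuous for the
  -- original topology, so the seminormed case applies.
  let S : SeminormedAddCommGroup E := p.toAddGroupSeminorm.toSeminormedAddCommGroup
  let N : @NormedSpace ℝ E _ S :=
    { ‹Module ℝ E› with norm_smul_le := fun a x => (map_smul_eq_mul p a x).le }
  refine @exists_norm_le_of_weakly_bounded E S N B fun L ⟨C, hC⟩ => ?_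
  have hc : Continuous L := by
    refine continuous_of_continuousAt_zero L ?_
    have h0 : Tendsto (fun x => C * p x) (𝓝 0) (𝓝 0) := by
      have := (hp.const_mul C).tendsto 0
      simpa using this
    rw [ContinuousAt, map_zero]
    exact squeeze_zero_norm (fun x => hC x) h0
  exact h ⟨L, hc⟩

/-- **Mackey's theorem**: weakly bounded subsets of a locally convex space are bounded. -/
theorem isVonNBounded_of_weakly_bounded [ContinuousSMul ℝ E] [LocallyConvexSpace ℝ E] {B : Set E}
    (h : ∀ L : E →L[ℝ] ℝ, ∃ M, ∀ x ∈ B, |L x| ≤ M) : IsVonNBounded ℝ B := by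
  rw [(PolynormableSpace.withSeminorms ℝ E).isVonNBounded_iff_seminorm_bounded]
  rintro ⟨p, hp⟩
  obtain ⟨M, hM⟩ := exists_seminorm_le_of_weakly_bounded hp h
  exact ⟨|M| + 1, by positivity, fun x hx =>
    (hM x hx).trans_lt ((le_abs_self M).trans_lt (lt_add_one _))⟩

end WeakBoundedness

/-! ### Divided differences -/

section Curves

variable {E : Type*} [AddCommGroup E] [Module ℝ E] [TopologicalSpace E]
  [IsTopologicalAddGroup E] [ContinuousSMul ℝ E]
variable {F : Type*} [AddCommGroup F] [Module ℝ F] [TopologicalSpace F]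
  [IsTopologicalAddGroup F] [ContinuousSMul ℝ F]

theorem isSmoothCurve_iff_contDiff {c : ℝ → ℝ} : IsSmoothCurve c ↔ ContDiff ℝ ∞ c := by
  refine ⟨fun h => contDiff_of_differentiable_iteratedDeriv (n := ⊤) fun m _ => ?_,
    fun h n => ?_⟩
  · rw [iteratedDeriv_eq_iterate]
    exact (h m).2
  · rw [← iteratedDeriv_eq_iterate]
    exact ⟨h.continuous_iteratedDeriv n (by exact_mod_cast le_top),
      h.differentiable_iteratedDeriv n (by exact_mod_cast WithTop.coe_lt_top n)⟩

theorem HasDerivAt.clm_comp (L : E →L[ℝ] F) {c : ℝ → E} {a : E} {t : ℝ}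
    (h : HasDerivAt c a t) : HasDerivAt (fun s => L (c s)) (L a) t := by
  rw [hasDerivAt_iff_tendsto_quotient] at h ⊢
  exact ((L.continuous.tendsto a).comp h).congr fun s => by simp

theorem IsSmoothCurve.contDiff_clm {c : ℝ → E} (hc : IsSmoothCurve c) (L : E →L[ℝ] ℝ) :
    ContDiff ℝ ∞ (fun t => L (c t)) :=
  isSmoothCurve_iff_contDiff.1 (hc.clm L)

/-- The second divided difference of a curve. -/
noncomputable def dividedDiff {E : Type*} [AddCommGroup E] [Module ℝ E] (c : ℝ → E) (t s u : ℝ) :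
    E :=
  (s - u)⁻¹ • ((s - t)⁻¹ • (c s - c t) - (u - t)⁻¹ • (c u - c t))

theorem map_dividedDiff {E F : Type*} [AddCommGroup E] [Module ℝ E] [AddCommGroup F] [Module ℝ F]
    (L : E →ₗ[ℝ] F) (c : ℝ → E) (t s u : ℝ) :
    L (dividedDiff c t s u) = dividedDiff (fun r => L (c r)) t s u := by
  simp [dividedDiff]

/-- The second divided differences with all nodes in `[-R, R]`. -/
def dividedDiffs {E : Type*} [AddCommGroup E] [Module ℝ E] (c : ℝ → E) (R : ℝ) : Set E :=
  {x | ∃ t s u : ℝ, s ≠ t ∧ u ≠ t ∧ |t| ≤ R ∧ |s| ≤ R ∧ |u| ≤ R ∧ dividedDiff c t s u = x}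

theorem abs_dividedDiff_le {f f' f'' : ℝ → ℝ} (hf : ∀ t, HasDerivAt f (f' t) t)
    (hf' : ∀ t, HasDerivAt f' (f'' t) t) {M R : ℝ} (hM : ∀ t, |t| ≤ R → |f'' t| ≤ M)
    {t s u : ℝ} (hst : s ≠ t) (hut : u ≠ t) (ht : |t| ≤ R) (hs : |s| ≤ R) (hu : |u| ≤ R) :
    |dividedDiff f t s u| ≤ M := by
  have hM0 : 0 ≤ M := (abs_nonneg _).trans (hM t ht)
  have hconv : ∀ r, |r| ≤ R → ∀ τ ∈ Icc (0 : ℝ) 1, |t + τ * (r - t)| ≤ R := fun r hr τ hτ => by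
    rw [abs_le] at *
    constructor <;> nlinarith [hτ.1, hτ.2]
  have h1 : ∀ a b, |a| ≤ R → |b| ≤ R → |f' a - f' b| ≤ M * |a - b| := fun a b ha hb => by
    have := (convex_Icc (-R) R).norm_image_sub_le_of_norm_hasDerivWithin_le
      (f := f') (f' := f'') (C := M) (fun x _ => (hf' x).hasDerivWithinAt)
      (fun x hx => hM x (abs_le.2 hx)) (abs_le.1 hb) (abs_le.1 ha)
    simpa [Real.norm_eq_abs] using this
  -- The difference of the two quotients is `k 1 - k 0`, and `k'` is a difference of values of `f'`
  -- at points at distance at most |s - u|.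
  let k : ℝ → ℝ := fun τ => (s - t)⁻¹ * f (t + τ * (s - t)) - (u - t)⁻¹ * f (t + τ * (u - t))
  have hk : ∀ τ, HasDerivAt k (f' (t + τ * (s - t)) - f' (t + τ * (u - t))) τ := fun τ => by
    have hlin : ∀ r, r ≠ t → HasDerivAt (fun τ => (r - t)⁻¹ * f (t + τ * (r - t)))
        (f' (t + τ * (r - t))) τ := fun r hr => by
      have e : HasDerivAt (fun τ => t + τ * (r - t)) (r - t) τ := by
        simpa using ((hasDerivAt_id τ).mul_const (r - t)).const_add t
      have := (HasDerivAt.comp τ (hf _) e).const_mul (r - t)⁻¹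
      rw [mul_comm (f' _), inv_mul_cancel_left₀ (sub_ne_zero.2 hr)] at this
      exact this
    exact (hlin s hst).sub (hlin u hut)
  have h2 := (convex_Icc (0 : ℝ) 1).norm_image_sub_le_of_norm_hasDerivWithin_le
    (f := k) (C := M * |s - u|) (fun x _ => (hk x).hasDerivWithinAt)
    (fun τ hτ => by
      refine (h1 _ _ (hconv s hs τ hτ) (hconv u hu τ hτ)).trans ?_
      have : t + τ * (s - t) - (t + τ * (u - t)) = τ * (s - u) := by ring
      rw [this, abs_mul, abs_of_nonneg hτ.1]
      gcongr
      exact mul_le_of_le_one_left (abs_nonneg _) hτ.2)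
    (left_mem_Icc.2 zero_le_one) (right_mem_Icc.2 zero_le_one)
  have h3 : k 1 - k 0 = (s - t)⁻¹ * (f s - f t) - (u - t)⁻¹ * (f u - f t) := by
    simp only [k, one_mul, zero_mul, add_zero, add_sub_cancel]
    ring
  rw [h3, sub_zero, norm_one, mul_one, Real.norm_eq_abs] at h2
  -- For s = u the divided difference is 0.
  rcases eq_or_ne s u with rfl | hsu
  · simpa [dividedDiff] using hM0
  · have : 0 < |s - u| := abs_pos.2 (sub_ne_zero.2 hsu)
    rw [dividedDiff, smul_eq_mul, smul_eq_mul, smul_eq_mul, abs_mul, abs_inv,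
      inv_mul_le_iff₀ this, mul_comm |s - u|]
    exact h2

theorem exists_bound_dividedDiff {f : ℝ → ℝ} (hf : ContDiff ℝ ∞ f) (R : ℝ) :
    ∃ M, ∀ x ∈ dividedDiffs f R, |x| ≤ M := by
  have hf' : ContDiff ℝ ∞ (deriv f) := (contDiff_infty_iff_deriv.1 hf).2
  have hf'' : ContDiff ℝ ∞ (deriv (deriv f)) := (contDiff_infty_iff_deriv.1 hf').2
  obtain ⟨M, hM⟩ := (isCompact_Icc (a := -R) (b := R)).exists_bound_of_continuousOn
    hf''.continuous.continuousOn
  refine ⟨M, ?_⟩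
  rintro _ ⟨t, s, u, hst, hut, ht, hs, hu, rfl⟩
  exact abs_dividedDiff_le (fun t => (contDiff_infty_iff_deriv.1 hf).1.differentiableAt.hasDerivAt)
    (fun t => (contDiff_infty_iff_deriv.1 hf').1.differentiableAt.hasDerivAt)
    (fun t ht => hM t (abs_le.1 ht)) hst hut ht hs hu

end Curves

/-! ### Differentiability from Mackey completeness -/

section Convenient

variable {E : Type*} [AddCommGroup E] [Module ℝ E] [TopologicalSpace E] [ConvenientSpace E]

theorem IsVonNBounded.exists_pos_smul_subset {E : Type*} [AddCommGroup E] [Module ℝ E]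
    [TopologicalSpace E] {B U : Set E} (hB : IsVonNBounded ℝ B)
    (hU : U ∈ 𝓝 0) : ∃ δ > 0, ∀ ε : ℝ, |ε| < δ → ∀ x ∈ B, ε • x ∈ U := by
  have h := tendsto_smallSets_iff.1 hB.tendsto_smallSets_nhds U hU
  obtain ⟨δ, hδ, h⟩ := Metric.eventually_nhds_iff.1 h
  exact ⟨δ, hδ, fun ε hε x hx => h (by simpa using hε) (smul_mem_smul_set hx)⟩

theorem IsVonNBounded.smul_le_one {B : Set E} (hB : IsVonNBounded ℝ B) :
    IsVonNBounded ℝ {y | ∃ r : ℝ, |r| ≤ 1 ∧ ∃ x ∈ B, r • x = y} := by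
  refine isVonNBounded_of_weakly_bounded fun L => ?_
  obtain ⟨M, hM⟩ := exists_bound_of_isVonNBounded hB L
  refine ⟨M, ?_⟩
  rintro _ ⟨r, hr, x, hx, rfl⟩
  rw [map_smul, smul_eq_mul, abs_mul]
  exact (mul_le_of_le_one_left (abs_nonneg _) hr).trans (hM x hx)

theorem tendsto_inv_one_div_add_one_div :
    Tendsto (fun p : ℕ × ℕ => (1 / ((p.1 : ℝ) + 1) + 1 / ((p.2 : ℝ) + 1))⁻¹) atTop atTop := by
  refine Tendsto.inv_tendsto_nhdsGT_zero (tendsto_nhdsWithin_iff.2 ⟨?_,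
    Eventually.of_forall fun p => by simp only [mem_Ioi]; positivity⟩)
  rw [← prod_atTop_atTop_eq]
  have h := tendsto_one_div_add_atTop_nhds_zero_nat (𝕜 := ℝ)
  simpa using (h.comp tendsto_fst).add (h.comp tendsto_snd)

/-- In a convenient vector space, a curve whose second divided differences are locally bounded is
differentiable. -/
theorem differentiable_of_isVonNBounded_dividedDiffs {c : ℝ → E}
    (hc : ∀ R, IsVonNBounded ℝ (dividedDiffs c R)) : Differentiable ℝ c := by
  intro t
  let q : ℝ → E := fun s => (s - t)⁻¹ • (c s - c t)
  let B := dividedDiffs c (|t| + 1)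
  have hB : IsVonNBounded ℝ B := hc _
  have hq : ∀ s u, s ≠ t → u ≠ t → |s - t| ≤ 1 → |u - t| ≤ 1 →
      ∃ x ∈ B, q s - q u = (s - u) • x := fun s u hs hu hs1 hu1 => by
    refine ⟨_, ⟨t, s, u, hs, hu, by linarith, ?_, ?_, rfl⟩, ?_⟩
    · have := abs_sub_abs_le_abs_sub s t; linarith
    · have := abs_sub_abs_le_abs_sub u t; linarith
    · rcases eq_or_ne s u with rfl | h
      · simp
      · rw [dividedDiff, smul_smul, mul_inv_cancel₀ (sub_ne_zero.2 h), one_smul]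
  let s : ℕ → ℝ := fun n => t + 1 / ((n : ℝ) + 1)
  have hs0 : ∀ n, s n ≠ t := fun n => by simp only [s, ne_eq, add_eq_left]; positivity
  have hs1 : ∀ n, |s n - t| ≤ 1 := fun n => by
    simp only [s, add_sub_cancel_left]
    rw [abs_of_pos (by positivity), div_le_one (by positivity)]
    linarith [n.cast_nonneg (α := ℝ)]
  have hst : Tendsto s atTop (𝓝 t) := by
    simpa [s] using (tendsto_one_div_add_atTop_nhds_zero_nat (𝕜 := ℝ)).const_add t
  obtain ⟨a, ha⟩ := ConvenientSpace.mackey_complete (fun n => q (s n))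
    -- The weight |s n - s m|⁻¹ would fail on the diagonal. The sum of the two distances to t stays
    -- positive and dominates |s n - s m|, leaving multiples of points of `B` with factor at most 1.
    ⟨fun p => (1 / ((p.1 : ℝ) + 1) + 1 / ((p.2 : ℝ) + 1))⁻¹, fun p => by positivity,
      tendsto_inv_one_div_add_one_div, (IsVonNBounded.smul_le_one hB).subset (by
        rintro _ ⟨⟨n, m⟩, rfl⟩
        obtain ⟨x, hx, e⟩ := hq (s n) (s m) (hs0 n) (hs0 m) (hs1 n) (hs1 m)
        refine ⟨(1 / ((n : ℝ) + 1) + 1 / ((m : ℝ) + 1))⁻¹ * (s n - s m), ?_, x, hx, ?_⟩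
        swap
        · simp only [e, smul_smul]
        have h1 : (0 : ℝ) < 1 / ((n : ℝ) + 1) := by positivity
        have h2 : (0 : ℝ) < 1 / ((m : ℝ) + 1) := by positivity
        have h3 : s n - s m = 1 / ((n : ℝ) + 1) - 1 / ((m : ℝ) + 1) := by simp only [s]; ring
        rw [h3, abs_mul, abs_inv, abs_of_pos (add_pos h1 h2), inv_mul_le_one₀ (add_pos h1 h2),
          abs_le]
        constructor <;> linarith)⟩
  have key : HasDerivAt c a t := by
    rw [hasDerivAt_iff_tendsto_quotient]
    have h0 : Tendsto (fun s => q s - a) (𝓝[≠] t) (𝓝 0) := by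
      refine (closed_nhds_basis (0 : E)).tendsto_right_iff.2 ?_
      rintro U ⟨hU, hUc⟩
      obtain ⟨δ, hδ, hδU⟩ := IsVonNBounded.exists_pos_smul_subset hB hU
      have hball : Metric.ball t (min δ 1) ∈ 𝓝 t := Metric.ball_mem_nhds _ (lt_min hδ one_pos)
      filter_upwards [self_mem_nhdsWithin, mem_nhdsWithin_of_mem_nhds hball] with r hr hrb
      rw [Metric.mem_ball, Real.dist_eq, lt_min_iff] at hrb
      -- Since `U` is closed, it suffices that `q r - q (s n)` lies in it for large n; this is a
      -- small multiple of a point of `B`.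
      refine hUc.mem_of_tendsto (ha.const_sub (q r)) ?_
      have h4 : ∀ᶠ n in atTop, |r - s n| < δ :=
        ((hst.const_sub r).abs).eventually (gt_mem_nhds hrb.1)
      filter_upwards [h4] with n hn
      obtain ⟨x, hx, e⟩ := hq r (s n) hr (hs0 n) hrb.2.le (hs1 n)
      rw [e]
      exact hδU _ hn x hx
    simpa using h0.add_const a
  exact (hasDerivAt_iff_hasFDerivAt.1 key).differentiableAt

theorem differentiable_of_contDiff_clm {c : ℝ → E}
    (hc : ∀ L : E →L[ℝ] ℝ, ContDiff ℝ ∞ (fun t => L (c t))) : Differentiable ℝ c := by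
  refine differentiable_of_isVonNBounded_dividedDiffs fun R =>
    isVonNBounded_of_weakly_bounded fun L => ?_
  obtain ⟨M, hM⟩ := exists_bound_dividedDiff (hc L) R
  refine ⟨M, ?_⟩
  rintro _ ⟨t, s, u, hst, hut, ht, hs, hu, rfl⟩
  refine hM _ ⟨t, s, u, hst, hut, ht, hs, hu, ?_⟩
  exact (map_dividedDiff L.toLinearMap c t s u).symm

theorem isSmoothCurve_of_differentiable {c : ℝ → E} (h : ∀ n, Differentiable ℝ (deriv^[n] c)) :
    IsSmoothCurve c := fun n => ⟨(h n).continuous, h n⟩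

/-- In a convenient vector space, weakly smooth curves are smooth. -/
theorem isSmoothCurve_of_contDiff_clm {c : ℝ → E}
    (hc : ∀ L : E →L[ℝ] ℝ, ContDiff ℝ ∞ (fun t => L (c t))) : IsSmoothCurve c := by
  suffices h : ∀ n, ∀ L : E →L[ℝ] ℝ, ContDiff ℝ ∞ (fun t => L (deriv^[n] c t)) from
    isSmoothCurve_of_differentiable fun n => differentiable_of_contDiff_clm (h n)
  intro n
  induction n with
  | zero => exact hc
  | succ n ih =>
    intro L
    have e : (fun t => L (deriv^[n + 1] c t)) = deriv (fun t => L (deriv^[n] c t)) := by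
      ext t
      rw [Function.iterate_succ_apply']
      exact (HasDerivAt.clm_comp L
        (hasDerivAt_deriv (differentiable_of_contDiff_clm ih t))).deriv.symm
    rw [e]
    exact (contDiff_infty_iff_deriv.1 (ih L)).2

theorem IsSmoothCurve.comp_contDiff {c : ℝ → E} (hc : IsSmoothCurve c) {a : ℝ → ℝ}
    (ha : ContDiff ℝ ∞ a) : IsSmoothCurve (fun t => c (a t)) :=
  isSmoothCurve_of_contDiff_clm fun L => (hc.contDiff_clm L).comp ha

end Convenient

/-! ### Bounded sets of smooth curves and smooth maps -/

section Bounded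

/-- Zero neighbourhoods of an infimum of topologies are generated by those of its members, and each
member leaves B bounded. -/
theorem isVonNBounded_bornologification {V : Type*} [AddCommGroup V] [Module ℝ V]
    {t : TopologicalSpace V} {B : Set V} (hB : @IsVonNBounded ℝ V _ _ _ t B) :
    @IsVonNBounded ℝ V _ _ _ (bornologification V t) B := by
  rw [@isVonNBounded_iff_absorbing_le _ _ _ _ _ (bornologification V t), nhds_sInf]
  exact le_iInf₂ fun s hs => hs.2.2.2 B hB

theorem isVonNBounded_iInf {V : Type*} {ι : Sort*} [AddCommGroup V] [Module ℝ V]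
    {t : ι → TopologicalSpace V} {B : Set V} (hB : ∀ i, @IsVonNBounded ℝ V _ _ _ (t i) B) :
    @IsVonNBounded ℝ V _ _ _ (⨅ i, t i) B := by
  rw [@isVonNBounded_iff_absorbing_le _ _ _ _ _ (⨅ i, t i), nhds_iInf]
  exact le_iInf fun i => hB i

theorem isVonNBounded_induced {V W : Type*} [AddCommGroup V] [Module ℝ V] [AddCommGroup W]
    [Module ℝ W] [tW : TopologicalSpace W] (L : V →ₗ[ℝ] W) {B : Set V}
    (hB : IsVonNBounded ℝ (L '' B)) :
    @IsVonNBounded ℝ V _ _ _ (tW.induced L) B := by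
  let _ : TopologicalSpace V := tW.induced L
  rw [isVonNBounded_iff_tendsto_smallSets_nhds, tendsto_smallSets_iff] at hB ⊢
  intro U hU
  rw [nhds_induced, map_zero, mem_comap] at hU
  obtain ⟨U', hU', hUU⟩ := hU
  filter_upwards [hB U' hU'] with ε hε
  rintro _ ⟨x, hx, rfl⟩
  refine hUU (hε ⟨L x, mem_image_of_mem L hx, ?_⟩)
  simp

variable {G : Type*} [AddCommGroup G] [Module ℝ G] [TopologicalSpace G]
  [IsTopologicalAddGroup G] [ContinuousSMul ℝ G]

theorem isVonNBounded_continuousMap {X : Type*} [TopologicalSpace X] {A : Set C(X, G)}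
    (hA : ∀ K : Set X, IsCompact K → IsVonNBounded ℝ {y | ∃ g ∈ A, ∃ t ∈ K, g t = y}) :
    IsVonNBounded ℝ A := by
  rw [isVonNBounded_iff_tendsto_smallSets_nhds, tendsto_smallSets_iff]
  intro U hU
  obtain ⟨⟨K, W⟩, ⟨hK, hW⟩, hUW⟩ :=
    ((𝓝 (0 : G)).basis_sets.nhds_continuousMapConst (X := X)).mem_iff.1 hU
  have h := tendsto_smallSets_iff.1 (hA K hK).tendsto_smallSets_nhds W hW
  filter_upwards [h] with ε hε
  rintro _ ⟨g, hg, rfl⟩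
  refine hUW fun t ht => hε ⟨g t, ⟨g, hg, t, ht, rfl⟩, rfl⟩

theorem exists_bound_of_isVonNBounded_continuousMap {A : Set C(ℝ, ℝ)} (hA : IsVonNBounded ℝ A)
    (R : ℝ) : ∃ M, ∀ g ∈ A, ∀ t, |t| ≤ R → |g t| ≤ M := by
  have hU : {g : C(ℝ, ℝ) | MapsTo g (Icc (-R) R) (Metric.ball 0 1)} ∈ 𝓝 (0 : C(ℝ, ℝ)) :=
    (ContinuousMap.isOpen_setOfPred_mapsTo isCompact_Icc Metric.isOpen_ball).mem_nhds
      fun t _ => by simp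
  obtain ⟨δ, hδ, h⟩ := IsVonNBounded.exists_pos_smul_subset hA hU
  refine ⟨(δ / 2)⁻¹, fun g hg t ht => ?_⟩
  have h1 := h (δ / 2) (by rw [abs_of_pos (half_pos hδ)]; exact half_lt_self hδ) g hg
    (abs_le.1 ht)
  rw [mem_ball_zero_iff, ContinuousMap.smul_apply, norm_smul, Real.norm_eq_abs, Real.norm_eq_abs,
    abs_of_pos (half_pos hδ)] at h1
  rw [← one_div, le_div_iff₀' (half_pos hδ)]
  exact h1.le

end Bounded

/-! ### Scalar jets as tests for boundedness -/

noncomputable section SmoothCurve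

variable {F : Type*} [AddCommGroup F] [Module ℝ F] [TopologicalSpace F]
variable {G : Type*} [AddCommGroup G] [Module ℝ G] [TopologicalSpace G]
  [IsTopologicalAddGroup G] [ContinuousSMul ℝ G] [T2Space G]

instance : IsTopologicalAddGroup (SmoothCurve G) := bornologification_addGroup _ _
instance : ContinuousSMul ℝ (SmoothCurve G) := bornologification_smul _ _
instance : LocallyConvexSpace ℝ (SmoothCurve G) := bornologification_lcs _ _

theorem IsSmoothCurve.iterate_deriv_add {c d : ℝ → G} (hc : IsSmoothCurve c)
    (hd : IsSmoothCurve d) (n : ℕ) : deriv^[n] (c + d) = deriv^[n] c + deriv^[n] d := by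
  refine iterate_deriv_eq (g := fun n => deriv^[n] c + deriv^[n] d) (fun n t => ?_) n
  have h1 := hasDerivAt_iff_tendsto_quotient.1 (hc.hasDerivAt n t)
  have h2 := hasDerivAt_iff_tendsto_quotient.1 (hd.hasDerivAt n t)
  refine hasDerivAt_iff_tendsto_quotient.2 ((h1.add h2).congr fun s => ?_)
  rw [← smul_add]
  congr 1
  simp only [Pi.add_apply]
  abel

theorem IsSmoothCurve.iterate_deriv_clm [IsTopologicalAddGroup F] [ContinuousSMul ℝ F]
    (L : F →L[ℝ] G) {c : ℝ → F} (hc : IsSmoothCurve c)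
    (n : ℕ) : deriv^[n] (fun t => L (c t)) = fun t => L (deriv^[n] c t) :=
  iterate_deriv_eq (g := fun n t => L (deriv^[n] c t))
    (fun n t => HasDerivAt.clm_comp L (hc.hasDerivAt n t)) n

/-- The `n`-th derivative as a linear map `C^∞(ℝ, G) → C(ℝ, G)`. -/
def SmoothCurve.iterDerivLinear (n : ℕ) : SmoothCurve G →ₗ[ℝ] C(ℝ, G) where
  toFun := SmoothCurve.iterDeriv n
  map_add' c d := ContinuousMap.ext fun t => congrFun (c.2.iterate_deriv_add d.2 n) t
  map_smul' a c := ContinuousMap.ext fun t =>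
    congrFun (c.2.iterate_deriv_clm (a • ContinuousLinearMap.id ℝ G) n) t

theorem SmoothCurve.continuous_iterDerivLinear [LocallyConvexSpace ℝ G] (n : ℕ) :
    Continuous (SmoothCurve.iterDerivLinear (G := G) n) :=
  continuous_bornologification _ (SmoothCurve.compactConvergence G) _
    (continuous_iff_le_induced.2 (iInf_le _ n))

theorem SmoothCurve.isVonNBounded_of_clm [LocallyConvexSpace ℝ G] {B : Set (SmoothCurve G)}
    (hB : ∀ (L : G →L[ℝ] ℝ) (n : ℕ) (R : ℝ), ∃ M, ∀ c ∈ B, ∀ t, |t| ≤ R →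
      |L (SmoothCurve.iterDeriv n c t)| ≤ M) : IsVonNBounded ℝ B := by
  refine isVonNBounded_bornologification (isVonNBounded_iInf fun n => ?_)
  have hn : IsVonNBounded ℝ (SmoothCurve.iterDerivLinear n '' B) → _ := isVonNBounded_induced _
  refine hn (isVonNBounded_continuousMap fun K hK => isVonNBounded_of_weakly_bounded fun L => ?_)
  obtain ⟨R, hR⟩ := hK.isBounded.subset_closedBall 0
  obtain ⟨M, hM⟩ := hB L n R
  refine ⟨M, ?_⟩
  rintro _ ⟨_, ⟨c, hc, rfl⟩, t, ht, rfl⟩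
  exact hM c hc t (by simpa using hR ht)

variable (F G) in
/-- The map `c^*` as a continuous linear map. -/
def SmoothMap.pullCurveCLM [LocallyConvexSpace ℝ G] {c : ℝ → F} (hc : IsSmoothCurve c) :
    SmoothMap F G →L[ℝ] SmoothCurve G where
  toFun := SmoothMap.pullCurve hc
  map_add' _ _ := rfl
  map_smul' _ _ := rfl
  cont := continuous_bornologification _ (SmoothMap.initialTopology F G)
    { toFun := SmoothMap.pullCurve hc, map_add' := fun _ _ => rfl, map_smul' := fun _ _ => rfl }
    (continuous_iff_le_induced.2 (iInf₂_le c hc))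

/-- The continuous linear map `f ↦ (L ∘ f ∘ c)⁽ⁿ⁾`, for a smooth curve `c` and a continuous
linear functional `L`. -/
def SmoothMap.jet [LocallyConvexSpace ℝ G] {c : ℝ → F} (hc : IsSmoothCurve c) (L : G →L[ℝ] ℝ)
    (n : ℕ) : SmoothMap F G →L[ℝ] C(ℝ, ℝ) where
  toFun f := (L : C(G, ℝ)).comp (SmoothCurve.iterDerivLinear n (SmoothMap.pullCurveCLM F G hc f))
  map_add' f g := by ext t; simp
  map_smul' a f := by ext t; simp
  cont := (ContinuousMap.continuous_postcomp _).comp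
    ((SmoothCurve.continuous_iterDerivLinear n).comp (SmoothMap.pullCurveCLM F G hc).continuous)

variable [LocallyConvexSpace ℝ G] {c : ℝ → F} (hc : IsSmoothCurve c) (L : G →L[ℝ] ℝ)

theorem SmoothMap.hasDerivAt_jet (n : ℕ) (f : SmoothMap F G) (t : ℝ) :
    HasDerivAt (SmoothMap.jet hc L n f) (SmoothMap.jet hc L (n + 1) f t) t :=
  HasDerivAt.clm_comp L ((f.smooth c hc).hasDerivAt n t)

/-- Jets are continuous and linear, hence preserve boundedness. Conversely both bornologifications
and both initial topologies are undone in turn, and Mackey's theorem reduces G to scalars. -/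
theorem SmoothMap.isVonNBounded_iff {B : Set (SmoothMap F G)} :
    IsVonNBounded ℝ B ↔ ∀ (c : ℝ → F) (hc : IsSmoothCurve c) (L : G →L[ℝ] ℝ) (n : ℕ) (R : ℝ),
      ∃ M, ∀ f ∈ B, ∀ t, |t| ≤ R → |SmoothMap.jet hc L n f t| ≤ M := by
  refine ⟨fun hB c hc L n R => ?_, fun hB => ?_⟩
  · obtain ⟨M, hM⟩ := exists_bound_of_isVonNBounded_continuousMap
      (hB.image (SmoothMap.jet hc L n)) R
    exact ⟨M, fun f hf => hM _ (mem_image_of_mem _ hf)⟩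
  · refine isVonNBounded_bornologification (isVonNBounded_iInf fun c => isVonNBounded_iInf
      fun hc => ?_)
    have h : IsVonNBounded ℝ ((SmoothMap.pullCurveCLM F G hc).toLinearMap '' B) → _ :=
      isVonNBounded_induced _
    refine h (SmoothCurve.isVonNBounded_of_clm fun L n R => ?_)
    obtain ⟨M, hM⟩ := hB c hc L n R
    refine ⟨M, ?_⟩
    rintro _ ⟨f, hf, rfl⟩
    exact hM f hf

end SmoothCurve

/-! ### Completeness of spaces of smooth maps -/

section Complete

theorem IsMackeyCauchy.tendsto_sub {E : Type*} [AddCommGroup E] [Module ℝ E] [TopologicalSpace E]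
    {x : ℕ → E} (hx : IsMackeyCauchy x) :
    Tendsto (fun p : ℕ × ℕ => x p.1 - x p.2) atTop (𝓝 0) := by
  obtain ⟨l, h0, h1, h2⟩ := hx
  refine tendsto_def.2 fun U hU => ?_
  obtain ⟨δ, hδ, h⟩ := IsVonNBounded.exists_pos_smul_subset h2 hU
  have h3 : ∀ᶠ p in atTop, (l p)⁻¹ < δ := h1.inv_tendsto_atTop.eventually (gt_mem_nhds hδ)
  filter_upwards [h3] with p hp
  have := h (l p)⁻¹ (by rwa [abs_of_pos (inv_pos.2 (h0 p))]) _ (mem_range_self p)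
  rwa [smul_smul, inv_mul_cancel₀ (h0 p).ne', one_smul] at this

theorem IsMackeyCauchy.exists_tendsto {E : Type*} [AddCommGroup E] [Module ℝ E] [UniformSpace E]
    [IsUniformAddGroup E] [CompleteSpace E] {x : ℕ → E} (hx : IsMackeyCauchy x) :
    ∃ a, Tendsto x atTop (𝓝 a) := by
  refine cauchySeq_tendsto_of_complete ?_
  rw [cauchySeq_iff_tendsto, uniformity_eq_comap_nhds_zero_swapped, tendsto_comap_iff]
  exact hx.tendsto_sub

instance convenientSpaceReal : ConvenientSpace ℝ where
  mackey_complete _ hx := hx.exists_tendsto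

theorem isUniformAddGroup_continuousMap : IsUniformAddGroup C(ℝ, ℝ) := by
  let φ : C(ℝ, ℝ) →+ (UniformOnFun ℝ ℝ {K | IsCompact K}) :=
    { toFun := ContinuousMap.toUniformOnFunIsCompact, map_zero' := rfl, map_add' := fun _ _ => rfl }
  have h := IsUniformAddGroup.comap φ
  have e : UniformSpace.comap φ inferInstance = ContinuousMap.compactConvergenceUniformSpace :=
    ContinuousMap.isUniformEmbedding_toUniformOnFunIsCompact.isUniformInducing.comap_uniformSpace
  rwa [e] at h

variable {F : Type*} [AddCommGroup F] [Module ℝ F] [TopologicalSpace F]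
  [IsTopologicalAddGroup F] [ContinuousSMul ℝ F] [T2Space F]
variable {G : Type*} [AddCommGroup G] [Module ℝ G] [TopologicalSpace G] [ConvenientSpace G]

/-- A Mackey-Cauchy sequence of smooth maps has a smooth limit for the convergence of all jets. -/
theorem SmoothMap.exists_tendsto_jet {x : ℕ → SmoothMap F G} (hx : IsMackeyCauchy x) :
    ∃ f : SmoothMap F G, ∀ (c : ℝ → F) (hc : IsSmoothCurve c) (L : G →L[ℝ] ℝ) (n : ℕ),
      Tendsto (fun k => jet hc L n (x k)) atTop (𝓝 (jet hc L n f)) := by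
  have h1 : ∀ y, ∃ a, Tendsto (fun k => x k y) atTop (𝓝 a) := fun y =>
    ConvenientSpace.mackey_complete _ (hx.clm
      (⟨evalLinear y, continuous_eval y⟩ : SmoothMap F G →L[ℝ] G))
  choose f hf using h1
  have := isUniformAddGroup_continuousMap
  have h2 : ∀ (c : ℝ → F) (hc : IsSmoothCurve c) (L : G →L[ℝ] ℝ) (n : ℕ),
      ∃ X : C(ℝ, ℝ), Tendsto (fun k => jet hc L n (x k)) atTop (𝓝 X) := fun c hc L n =>
    (hx.clm (jet hc L n)).exists_tendsto
  choose X hX using h2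
  have hX0 : ∀ (c : ℝ → F) (hc : IsSmoothCurve c) (L : G →L[ℝ] ℝ),
      ⇑(X c hc L 0) = fun t => L (f (c t)) := fun c hc L => by
    ext t
    have h3 := ((ContinuousEvalConst.continuous_eval_const t).tendsto _).comp (hX c hc L 0)
    exact tendsto_nhds_unique h3 ((L.continuous.tendsto _).comp (hf (c t)))
  have hXd : ∀ (c : ℝ → F) (hc : IsSmoothCurve c) (L : G →L[ℝ] ℝ) (n : ℕ) (t : ℝ),
      HasDerivAt (X c hc L n) (X c hc L (n + 1) t) t := fun c hc L n t => by
    -- Locally uniform convergence of the next jets allows differentiating the limit.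
    refine hasDerivAt_of_tendstoLocallyUniformlyOn (l := atTop) isOpen_univ
      (tendstoLocallyUniformlyOn_univ.2
        (ContinuousMap.tendsto_iff_tendstoLocallyUniformly.1 (hX c hc L (n + 1))))
      (Eventually.of_forall fun k t _ => hasDerivAt_jet hc L n (x k) t) (fun t _ => ?_)
      (mem_univ t)
    exact ((ContinuousEvalConst.continuous_eval_const t).tendsto _).comp (hX c hc L n)
  have hfs : IsSmoothMap f := fun c hc => isSmoothCurve_of_contDiff_clm fun L => by
    rw [← isSmoothCurve_iff_contDiff]
    have := isSmoothCurve_of_seq (g := fun n => X c hc L n) (fun n => (X c hc L n).continuous)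
      (hXd c hc L)
    simpa only [hX0, Function.comp_apply] using this
  refine ⟨⟨f, hfs⟩, fun c hc L n => ?_⟩
  have e : jet hc L n (⟨f, hfs⟩ : SmoothMap F G) = X c hc L n := by
    refine DFunLike.coe_injective ?_
    rw [← iterate_deriv_eq (g := fun n => X c hc L n) (hXd c hc L) n,
      ← iterate_deriv_eq (g := fun n => jet hc L n (⟨f, hfs⟩ : SmoothMap F G))
        (fun n t => hasDerivAt_jet hc L n _ t) n, hX0]
    rfl
  rw [e]
  exact hX c hc L n

instance SmoothMap.convenientSpace : ConvenientSpace (SmoothMap F G) where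
  mackey_complete x hx := by
    obtain ⟨f, hf⟩ := SmoothMap.exists_tendsto_jet hx
    obtain ⟨l, h0, h1, h2⟩ := hx
    refine ⟨f, ?_⟩
    -- One weight per n that works for all m ≥ n, so that m can tend to infinity. Then μ n • (x n -
    -- f) is bounded and μ n → ∞, which forces convergence in the bornological topology, where jet
    -- convergence alone would not suffice.
    let μ : ℕ → ℝ := fun n => sInf ((fun m => l (n, m)) '' Ici n)
    have hμl : ∀ n m, n ≤ m → μ n ≤ l (n, m) := fun n m hnm =>
      csInf_le ⟨0, by rintro _ ⟨m, -, rfl⟩; exact (h0 _).le⟩ (mem_image_of_mem _ hnm)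
    have hμ0 : ∀ n, 0 ≤ μ n := fun n =>
      le_csInf (nonempty_Ici.image _) (by rintro _ ⟨m, -, rfl⟩; exact (h0 _).le)
    have hμ : Tendsto μ atTop atTop := by
      refine tendsto_atTop.2 fun N => ?_
      obtain ⟨⟨a, b⟩, hab⟩ := eventually_atTop.1 (tendsto_atTop.1 h1 N)
      filter_upwards [eventually_ge_atTop (max a b)] with n hn
      refine le_csInf (nonempty_Ici.image _) ?_
      rintro _ ⟨m, hm, rfl⟩
      exact hab (n, m) ⟨(le_max_left _ _).trans hn,
        (le_max_right _ _).trans (hn.trans hm)⟩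
    have hB : IsVonNBounded ℝ (range fun n => μ n • (x n - f)) := by
      rw [SmoothMap.isVonNBounded_iff] at h2 ⊢
      intro c hc L k R
      obtain ⟨M, hM⟩ := h2 c hc L k R
      refine ⟨M, ?_⟩
      rintro _ ⟨n, rfl⟩ t ht
      have h3 := ((ContinuousEvalConst.continuous_eval_const t).tendsto _).comp (hf c hc L k)
      have h4 : Tendsto (fun m => |μ n * (SmoothMap.jet hc L k (x n) t -
          SmoothMap.jet hc L k (x m) t)|) atTop
          (𝓝 |μ n * (SmoothMap.jet hc L k (x n) t - SmoothMap.jet hc L k f t)|) :=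
        ((h3.const_sub _).const_mul _).abs
      have h5 : SmoothMap.jet hc L k (μ n • (x n - f)) t =
          μ n * (SmoothMap.jet hc L k (x n) t - SmoothMap.jet hc L k f t) := by simp
      rw [h5]
      refine le_of_tendsto h4 ?_
      filter_upwards [eventually_ge_atTop n] with m hm
      have h6 := hM _ (mem_range_self (n, m)) t ht
      simp only [map_smul, map_sub, ContinuousMap.smul_apply, ContinuousMap.sub_apply,
        smul_eq_mul, abs_mul, abs_of_pos (h0 (n, m))] at h6
      rw [abs_mul, abs_of_nonneg (hμ0 n)]
      exact (mul_le_mul_of_nonneg_right (hμl n m hm) (abs_nonneg _)).trans h6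
    have h7 : Tendsto (fun n => x n - f) atTop (𝓝 0) := by
      refine tendsto_def.2 fun U hU => ?_
      obtain ⟨δ, hδ, h⟩ := IsVonNBounded.exists_pos_smul_subset hB hU
      filter_upwards [hμ.inv_tendsto_atTop.eventually (gt_mem_nhds hδ),
        hμ.eventually_gt_atTop 0] with n hn hn0
      have := h (μ n)⁻¹ (by rwa [abs_of_pos (inv_pos.2 hn0)]) _ (mem_range_self n)
      rwa [smul_smul, inv_mul_cancel₀ hn0.ne', one_smul] at this
    simpa using h7.add_const f

end Complete

/-! ### The exponential law -/

noncomputable section Curry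

theorem HasDerivAt.partial_fst {φ : ℝ × ℝ → ℝ} (hφ : ContDiff ℝ ∞ φ) (s r : ℝ) :
    HasDerivAt (fun s => φ (s, r)) (fderiv ℝ φ (s, r) (1, 0)) s := by
  have h := ((hφ.differentiable (by simp)) (s, r)).hasFDerivAt
  exact h.comp_hasDerivAt s ((hasDerivAt_id s).prodMk (hasDerivAt_const s r))

theorem HasDerivAt.partial_snd {φ : ℝ × ℝ → ℝ} (hφ : ContDiff ℝ ∞ φ) (s r : ℝ) :
    HasDerivAt (fun r => φ (s, r)) (fderiv ℝ φ (s, r) (0, 1)) r := by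
  have h := ((hφ.differentiable (by simp)) (s, r)).hasFDerivAt
  exact h.comp_hasDerivAt r ((hasDerivAt_const r s).prodMk (hasDerivAt_id r))

theorem contDiff_fderiv_const {φ : ℝ × ℝ → ℝ} (hφ : ContDiff ℝ ∞ φ) (v : ℝ × ℝ) :
    ContDiff ℝ ∞ (fun p => fderiv ℝ φ p v) :=
  (hφ.fderiv_right (m := ∞) (by simp)).clm_apply contDiff_const

variable {A F G : Type*} [AddCommGroup A] [Module ℝ A] [TopologicalSpace A] [ConvenientSpace A]
  [AddCommGroup F] [Module ℝ F] [TopologicalSpace F] [ConvenientSpace F]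
  [AddCommGroup G] [Module ℝ G] [TopologicalSpace G] [ConvenientSpace G]

theorem IsSmoothCurve.fst {c : ℝ → A × F} (hc : IsSmoothCurve c) :
    IsSmoothCurve (fun t => (c t).1) :=
  hc.clm (ContinuousLinearMap.fst ℝ A F)

theorem IsSmoothCurve.snd {c : ℝ → A × F} (hc : IsSmoothCurve c) :
    IsSmoothCurve (fun t => (c t).2) :=
  hc.clm (ContinuousLinearMap.snd ℝ A F)

theorem IsSmoothCurve.contDiff_fst {c : ℝ → ℝ × F} (hc : IsSmoothCurve c) :
    ContDiff ℝ ∞ (fun t => (c t).1) :=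
  hc.contDiff_clm (ContinuousLinearMap.fst ℝ ℝ F)

/-- The partial map `f(x, ·)` of a smooth map. -/
def SmoothMap.slice {A : Type*} [AddCommGroup A] [Module ℝ A] [TopologicalSpace A]
    [IsTopologicalAddGroup A] [ContinuousSMul ℝ A] [T2Space A] {f : A × F → G}
    (hf : IsSmoothMap f) (x : A) : SmoothMap F G :=
  ⟨fun y => f (x, y), fun c hc => hf (fun t => (x, c t)) ((IsSmoothCurve.const x).prodMk hc)⟩

/-- The partial derivative of `f : ℝ × F → G` in the real variable. -/
def paramDeriv (f : ℝ × F → G) (p : ℝ × F) : G := deriv (fun s => f (s, p.2)) p.1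

theorem isSmoothCurve_param {f : ℝ × F → G} (hf : IsSmoothMap f) {a : ℝ → ℝ}
    (ha : ContDiff ℝ ∞ a) {d : ℝ → F} (hd : IsSmoothCurve d) :
    IsSmoothCurve (fun t => f (a t, d t)) :=
  hf (fun t => (a t, d t)) ((isSmoothCurve_iff_contDiff.2 ha).prodMk hd)

theorem hasDerivAt_paramDeriv {f : ℝ × F → G} (hf : IsSmoothMap f) (s : ℝ) (y : F) :
    HasDerivAt (fun s => f (s, y)) (paramDeriv f (s, y)) s :=
  (isSmoothCurve_param hf contDiff_id (IsSmoothCurve.const y)).hasDerivAt 0 s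

theorem isSmoothMap_paramDeriv {f : ℝ × F → G} (hf : IsSmoothMap f) :
    IsSmoothMap (paramDeriv f) := by
  intro c hc
  have ha := hc.contDiff_fst
  have hd := hc.snd
  refine isSmoothCurve_of_contDiff_clm fun L => ?_
  -- The extra variable shifts the real parameter only, so the partial derivative along c is ∂φ/∂r
  -- at r = 0, and φ is jointly smooth by Boman.
  let φ : ℝ × ℝ → ℝ := fun p => L (f ((c p.1).1 + p.2, (c p.1).2))
  have hφ : ContDiff ℝ ∞ φ := contDiff_of_comp_curve_prod fun α β hα hβ =>
    (isSmoothCurve_param hf ((ha.comp hα).add hβ) (hd.comp_contDiff hα)).contDiff_clm L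
  have e : (fun t => L ((paramDeriv f ∘ c) t)) = fun t => fderiv ℝ φ (t, 0) (0, 1) := by
    ext t
    have h1 : HasDerivAt (fun s => L (f (s, (c t).2))) (L (paramDeriv f (c t))) ((c t).1 + 0) := by
      rw [add_zero]
      exact HasDerivAt.clm_comp L (hasDerivAt_paramDeriv hf (c t).1 (c t).2)
    exact (h1.comp_const_add (c t).1 0).unique (HasDerivAt.partial_snd hφ t 0)
  rw [e]
  exact (contDiff_fderiv_const hφ (0, 1)).comp (contDiff_id.prodMk contDiff_const)

theorem contDiff_jet_slice {f : ℝ × F → G} (hf : IsSmoothMap f) {c : ℝ → F}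
    (hc : IsSmoothCurve c) (L : G →L[ℝ] ℝ) (n : ℕ) :
    ContDiff ℝ ∞ (fun p : ℝ × ℝ => SmoothMap.jet hc L n (SmoothMap.slice hf p.1) p.2) := by
  induction n with
  | zero =>
    exact contDiff_of_comp_curve_prod fun α β hα hβ =>
      (isSmoothCurve_param hf hα (hc.comp_contDiff hβ)).contDiff_clm L
  | succ n ih =>
    have e : (fun p : ℝ × ℝ => SmoothMap.jet hc L (n + 1) (SmoothMap.slice hf p.1) p.2) =
        fun p => fderiv ℝ (fun p : ℝ × ℝ => SmoothMap.jet hc L n (SmoothMap.slice hf p.1) p.2) p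
          (0, 1) := by
      ext ⟨s, r⟩
      exact (SmoothMap.hasDerivAt_jet hc L n (SmoothMap.slice hf s) r).unique
        (HasDerivAt.partial_snd ih s r)
    rw [e]
    exact contDiff_fderiv_const ih _

/-- The jets of the slices form a smooth function on ℝ²; its second derivative in the parameter is
bounded on a rectangle and bounds all divided differences. -/
theorem differentiable_slice {f : ℝ × F → G} (hf : IsSmoothMap f) :
    Differentiable ℝ (SmoothMap.slice hf) := by
  refine differentiable_of_isVonNBounded_dividedDiffs fun R => ?_
  rw [SmoothMap.isVonNBounded_iff]
  intro c hc L n R'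
  let ψ : ℝ × ℝ → ℝ := fun p => SmoothMap.jet hc L n (SmoothMap.slice hf p.1) p.2
  have hψ : ContDiff ℝ ∞ ψ := contDiff_jet_slice hf hc L n
  have hψ1 := contDiff_fderiv_const hψ (1, 0)
  have hψ2 := contDiff_fderiv_const hψ1 (1, 0)
  obtain ⟨M, hM⟩ := (((isCompact_Icc (a := -R) (b := R)).prod
    (isCompact_Icc (a := -R') (b := R')))).exists_bound_of_continuousOn hψ2.continuous.continuousOn
  refine ⟨M, ?_⟩
  rintro _ ⟨t, s, u, hst, hut, ht, hs, hu, rfl⟩ r hr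
  have e := map_dividedDiff ((ContinuousMap.evalCLM ℝ r).comp (SmoothMap.jet hc L n)).toLinearMap
    (SmoothMap.slice hf) t s u
  have e' : SmoothMap.jet hc L n (dividedDiff (SmoothMap.slice hf) t s u) r =
    dividedDiff (fun s => ψ (s, r)) t s u := e
  rw [e']
  exact abs_dividedDiff_le (fun t => HasDerivAt.partial_fst hψ t r)
    (fun t => HasDerivAt.partial_fst hψ1 t r)
    (fun t ht => hM (t, r) ⟨abs_le.1 ht, abs_le.1 hr⟩) hst hut ht hs hu

/-- Evaluation at a point as a continuous linear map. -/
def SmoothMap.evalCLM (y : F) : SmoothMap F G →L[ℝ] G :=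
  ⟨SmoothMap.evalLinear y, SmoothMap.continuous_eval y⟩

theorem deriv_slice {f : ℝ × F → G} (hf : IsSmoothMap f) :
    deriv (SmoothMap.slice hf) = SmoothMap.slice (isSmoothMap_paramDeriv hf) := by
  ext t y
  have h1 : HasDerivAt (fun s => f (s, y)) (deriv (SmoothMap.slice hf) t y) t :=
    HasDerivAt.clm_comp (SmoothMap.evalCLM y) (hasDerivAt_deriv (differentiable_slice hf t))
  rw [← deriv_eq_of_hasDerivAt h1, deriv_eq_of_hasDerivAt (hasDerivAt_paramDeriv hf t y)]
  rfl

theorem isSmoothCurve_slice {f : ℝ × F → G} (hf : IsSmoothMap f) :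
    IsSmoothCurve (SmoothMap.slice hf) := by
  refine isSmoothCurve_of_differentiable fun n => ?_
  induction n generalizing f with
  | zero => exact differentiable_slice hf
  | succ n ih =>
    rw [Function.iterate_succ_apply, deriv_slice]
    exact ih (isSmoothMap_paramDeriv hf)

theorem isSmoothMap_slice {f : A × F → G} (hf : IsSmoothMap f) :
    IsSmoothMap (SmoothMap.slice hf) := by
  intro c hc
  have h : IsSmoothMap (fun p : ℝ × F => f (c p.1, p.2)) := fun e he =>
    hf (fun t => (c (e t).1, (e t).2))
      ((hc.comp_contDiff he.contDiff_fst).prodMk he.snd)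
  exact isSmoothCurve_slice h

/-- The quotient splits into the quotient of `σ` in C(ℝ, ℝ), evaluated at the moving point, and that
of the fixed jet of `σ t`. The first converges by joint continuity of evaluation. -/
theorem hasDerivAt_jet_diag {σ : ℝ → SmoothMap F G} {y : ℝ → F}
    (hy : IsSmoothCurve y) (L : G →L[ℝ] ℝ) (m : ℕ) {σ' : SmoothMap F G} {t : ℝ}
    (hσ : HasDerivAt σ σ' t) :
    HasDerivAt (fun s => SmoothMap.jet hy L m (σ s) s)
      (SmoothMap.jet hy L m σ' t + SmoothMap.jet hy L (m + 1) (σ t) t) t := by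
  have h1 := hasDerivAt_iff_tendsto_quotient.1
    (HasDerivAt.clm_comp (SmoothMap.jet hy L m) hσ)
  have h2 := hasDerivAt_iff_tendsto_quotient.1 (SmoothMap.hasDerivAt_jet hy L m (σ t) t)
  have hid : Tendsto (fun s : ℝ => s) (𝓝[≠] t) (𝓝 t) := tendsto_id.mono_left nhdsWithin_le_nhds
  have h3 := ((ContinuousEval.continuous_eval (F := C(ℝ, ℝ))).tendsto
    (SmoothMap.jet hy L m σ', t)).comp (h1.prodMk_nhds hid)
  refine hasDerivAt_iff_tendsto_quotient.2 ((h3.add h2).congr fun s => ?_)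
  simp only [Function.comp_apply, ContinuousMap.smul_apply, ContinuousMap.sub_apply, smul_eq_mul]
  ring

theorem isSmoothMap_uncurry {g : A → SmoothMap F G} (hg : IsSmoothMap g) :
    IsSmoothMap (fun p : A × F => g p.1 p.2) := by
  intro e he
  have hσ := hg _ he.fst
  have hy := he.snd
  refine isSmoothCurve_of_contDiff_clm fun L => contDiff_infty.2 fun k => ?_
  -- Differentiation raises n in one term and m in the other, so the induction on k must cover all
  -- pairs.
  suffices h : ∀ n m : ℕ, ContDiff ℝ k (fun t =>
      SmoothMap.jet hy L m (deriv^[n] (g ∘ fun t => (e t).1) t) t) from h 0 0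
  have hd : ∀ n m t, HasDerivAt (fun t =>
      SmoothMap.jet hy L m (deriv^[n] (g ∘ fun t => (e t).1) t) t) _ t := fun n m t =>
    hasDerivAt_jet_diag hy L m (hσ.hasDerivAt n t)
  induction k with
  | zero =>
    exact fun n m => contDiff_zero.2 (Differentiable.continuous (𝕜 := ℝ)
      fun t => (hd n m t).differentiableAt)
  | succ k ih =>
    intro n m
    push_cast
    rw [contDiff_succ_iff_deriv]
    refine ⟨fun t => (hd n m t).differentiableAt, by simp, ?_⟩
    rw [funext fun t => (hd n m t).deriv]
    exact (ih (n + 1) m).add (ih n (m + 1))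

end Curry

/-! ### Currying as a diffeomorphism -/

noncomputable section ExponentialLaw

variable {E F G : Type*} [AddCommGroup E] [Module ℝ E] [TopologicalSpace E] [ConvenientSpace E]
  [AddCommGroup F] [Module ℝ F] [TopologicalSpace F] [ConvenientSpace F]
  [AddCommGroup G] [Module ℝ G] [TopologicalSpace G] [ConvenientSpace G]

theorem IsSmoothCurve.isSmoothMap {c : ℝ → E} (hc : IsSmoothCurve c) : IsSmoothMap c :=
  fun _ ha => hc.comp_contDiff (isSmoothCurve_iff_contDiff.1 ha)

theorem IsSmoothMap.isSmoothCurve {c : ℝ → E} (hc : IsSmoothMap c) : IsSmoothCurve c :=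
  hc id (isSmoothCurve_iff_contDiff.2 contDiff_id)

variable (E F G) in
/-- The exponential law for smooth maps between convenient vector spaces. -/
def SmoothMap.curryEquiv : SmoothMap (E × F) G ≃ SmoothMap E (SmoothMap F G) where
  toFun f := ⟨SmoothMap.slice f.smooth, isSmoothMap_slice f.smooth⟩
  invFun g := ⟨fun p => g p.1 p.2, isSmoothMap_uncurry g.smooth⟩
  left_inv _ := rfl
  right_inv _ := rfl

/-- A smooth curve of maps on E × F is a smooth map on ℝ × (E × F); reassociating and slicing twice
gives its image. -/
theorem SmoothMap.isSmoothMap_curryEquiv : IsSmoothMap (SmoothMap.curryEquiv E F G) := by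
  intro γ hγ
  have h1 := isSmoothMap_uncurry hγ.isSmoothMap
  have h2 : IsSmoothMap (fun p : (ℝ × E) × F => γ p.1.1 (p.1.2, p.2)) := fun c hc =>
    h1 _ (hc.fst.fst.prodMk (hc.fst.snd.prodMk hc.snd))
  exact (isSmoothMap_slice (isSmoothMap_slice h2)).isSmoothCurve

theorem SmoothMap.isSmoothMap_curryEquiv_symm :
    IsSmoothMap (SmoothMap.curryEquiv E F G).symm := by
  intro γ hγ
  have h1 := isSmoothMap_uncurry (isSmoothMap_uncurry hγ.isSmoothMap)
  have h2 : IsSmoothMap (fun p : ℝ × (E × F) => γ p.1 p.2.1 p.2.2) := fun c hc =>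
    h1 _ ((hc.fst.prodMk hc.snd.fst).prodMk hc.snd.snd)
  exact (isSmoothMap_slice h2).isSmoothCurve

end ExponentialLaw

/-! ### Cartesian closedness -/

noncomputable section Closed

open MonoidalCategory

/-- The adjunction homset equivalence: `(A × X → Y) ≃ (X → C^∞(A, Y))`. -/
def ConvenientCat.homEquiv (A X Y : ConvenientCat.{u}) :
    (A ⊗ X ⟶ Y) ≃ (X ⟶ (⟨SmoothMap A Y⟩ : ConvenientCat.{u})) where
  -- The exponent is the left factor here but the right one in `SmoothMap.curryEquiv`, hence the
  -- swap.
  toFun f := SmoothMap.curryEquiv X A Y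
    (SmoothMap.comp (E := X × A) (F := A × X) (G := Y) f (SmoothMap.pair SmoothMap.snd SmoothMap.fst))
  invFun g := SmoothMap.comp (E := A × X) (F := X × A) (G := Y) ((SmoothMap.curryEquiv X A Y).symm g)
    (SmoothMap.pair SmoothMap.snd SmoothMap.fst)
  left_inv _ := rfl
  right_inv _ := rfl

instance ConvenientCat.monoidalClosed : MonoidalClosed ConvenientCat.{u} where
  closed A :=
    { rightAdj := Adjunction.rightAdjointOfEquiv (F := tensorLeft A)
        (ConvenientCat.homEquiv A) (fun _ _ _ _ _ => rfl)
      adj := Adjunction.adjunctionOfEquivRight _ _ }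

end Closed

end Convenient

open Convenient in
theorem mainTheorem1 :
    -- the category of convenient vector spaces and smooth maps is cartesian closed
    Nonempty (MonoidalClosed ConvenientCat.{u}) ∧
    -- function spaces between convenient vector spaces are convenient
    (∀ (F : ConvenientCat.{v}) (G : ConvenientCat.{w}), ConvenientSpace (SmoothMap F G)) ∧
    -- the exponential law: a natural bijection given by `f ↦ (x ↦ (y ↦ f (x, y)))`,
    -- which is a diffeomorphism
    ∃ Φ : ∀ (E : ConvenientCat.{u}) (F : ConvenientCat.{v}) (G : ConvenientCat.{w}),
        SmoothMap (E × F) G ≃ SmoothMap E (SmoothMap F G),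
      (∀ (E : ConvenientCat.{u}) (F : ConvenientCat.{v}) (G : ConvenientCat.{w})
        (f : SmoothMap (E × F) G) (x : E) (y : F), Φ E F G f x y = f (x, y)) ∧
      (∀ (E : ConvenientCat.{u}) (F : ConvenientCat.{v}) (G : ConvenientCat.{w}),
        IsSmoothMap (Φ E F G) ∧ IsSmoothMap (Φ E F G).symm) ∧
      (∀ (E E' : ConvenientCat.{u}) (F F' : ConvenientCat.{v}) (G G' : ConvenientCat.{w})
        (a : SmoothMap E' E) (b : SmoothMap F' F) (h : SmoothMap G G')
        (f : SmoothMap (E × F) G) (x : E'),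
        Φ E' F' G' (h.comp (f.comp ((a.comp SmoothMap.fst).pair (b.comp SmoothMap.snd)))) x =
          h.comp ((Φ E F G f (a x)).comp b)) :=

  ⟨⟨ConvenientCat.monoidalClosed⟩, fun _ _ => SmoothMap.convenientSpace,
    fun E F G => SmoothMap.curryEquiv E F G, fun _ _ _ _ _ _ => rfl,
    fun _ _ _ => ⟨SmoothMap.isSmoothMap_curryEquiv, SmoothMap.isSmoothMap_curryEquiv_symm⟩,
    fun _ _ _ _ _ _ _ _ _ _ _ => rfl⟩
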